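/- Let $k$ be a field and $n\ge 0$ an integer. A bound quiver $Q=(Q_0,Q_1,\rho)$ has finitely many arrows between any two vertices, and each element of $\rho$ is a linear combination of paths with the same source, the same target and the same length, which is at least $2$. A path, or a linear combination of parallel paths, is called bound if its image in $kQ/(\rho)$ is nonzero. A bound path is maximal if no arrow prolongs it, at either end, to a bound path. The bound quiver $Q$ is $n$-homogeneous if all its maximal bound paths have length $n$. A bound quiver $\overline Q$ is a stable $n$-translation quiver with $n$-translation $\tau$, a bijection $\tau:\overline Q_0\to\overline Q_0$, if the following hold: all bound paths have length at most $n+1$; every maximal bound path has length $n+1$ and goes from $\tau i$ to $i$ for some vertex $i$; any two bound paths of length $n+1$ from $\tau i$ to $i$ have linearly dependent images; for every bound linear combination $u$ of paths of the same length $t\le n+1$ from $j$ to $i$ there is a path $q$ of length $n+1-t$ from $\tau i$ to $j$ with $uq$ bound; and for every bound linear combination $u$ of paths of the same length $t\le n+1$ from $\tau i$ to $j$ there is a path $q$ of length $n+1-t$ from $j$ to $i$ with $qu$ bound. If $\overline Q$ is acyclic with finitely many $\tau$-orbits, a complete $\tau$-slice of $\overline Q$ is a full subquiver that meets each $\tau$-orbit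 in exactly one vertex and contains every path of $\overline Q$ whose end points it contains; it is bound by the relations of $\overline Q$ between its vertices. A $k$-algebra is a $\tau$-slice algebra (for $n$) if it is isomorphic to the bound quiver algebra of a complete $\tau$-slice of some acyclic stable $n$-translation quiver with finitely many $\tau$-orbits. **Proposition.** Let $\Lambda\cong kQ/(\rho)$ be an algebra whose bound quiver $Q=(Q_0,Q_1,\rho)$ is acyclic with $Q_0$ finite, graded by the length of paths, and let $D\Lambda=\operatorname{Hom}_k(\Lambda,k)$, with $D\Lambda_n\subseteq D\Lambda$ the functionals that vanish on $\Lambda_t$ for all $t\ne n$. Then $\Lambda$ is a $\tau$-slice algebra if and only if $Q$ is $n$-homogeneous and $D\Lambda$ is generated by $D\Lambda_n$ as a $\Lambda$-bimodule. -/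

import Mathlib

open Quiver

universe w u v u' v'

noncomputable section

/-- A quiver is acyclic if it has no path of positive length from a vertex to itself. -/
def QuiverAcyclic (V : Type u) [Quiver.{v} V] : Prop :=
  ∀ (i : V) (p : Path i i), p.length = 0

/-- A bound quiver over `k` on the quiver `V`: only finitely many arrows between any two vertices,
and a set of relations, each of which is a linear combination of paths with the same source, the
same target and the same length, this length being at least two. -/
structure BoundQuiver (k : Type w) [Field k] (V : Type u) [Quiver.{v} V] where
  finite_arrows : ∀ i j : V, Finite (i ⟶ j)
  rels : ∀ i j : V, Set (Path i j →₀ k)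
  rels_homogeneous : ∀ (i j : V), ∀ r ∈ rels i j, ∃ t : ℕ, 2 ≤ t ∧ ∀ p ∈ r.support, p.length = t

namespace BoundQuiver

variable {k : Type w} [Field k] {V : Type u} [Quiver.{v} V]

/-- The bilinear composition of linear combinations of paths, the left argument being the part that
is travelled first. -/
def pathComp (k : Type w) [Field k] {V : Type u} [Quiver.{v} V] (i j l : V) :
    (Path i j →₀ k) →ₗ[k] (Path j l →₀ k) →ₗ[k] (Path i l →₀ k) :=
  Finsupp.linearCombination k fun p : Path i j =>
    Finsupp.lmapDomain k k fun q : Path j l => p.comp q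

theorem pathComp_single (i j l : V) (p : Path i j) (q : Path j l) (a b : k) :
    pathComp k i j l (Finsupp.single p a) (Finsupp.single q b) =
      Finsupp.single (p.comp q) (a * b) := by
  simp [pathComp, Finsupp.linearCombination_single, Finsupp.mapDomain_single]

theorem pathComp_assoc (i j l m : V) (x : Path i j →₀ k) (y : Path j l →₀ k) (z : Path l m →₀ k) :
    pathComp k i l m (pathComp k i j l x y) z = pathComp k i j m x (pathComp k j l m y z) := by
  induction x using Finsupp.induction_linear with
  | zero => simp
  | add x₁ x₂ h₁ h₂ => simp [h₁, h₂]
  | single p a =>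
    induction y using Finsupp.induction_linear with
    | zero => simp
    | add y₁ y₂ h₁ h₂ => simp [h₁, h₂]
    | single q b =>
      induction z using Finsupp.induction_linear with
      | zero => simp
      | add z₁ z₂ h₁ h₂ => simp [h₁, h₂]
      | single s c => simp only [pathComp_single, mul_assoc, Path.comp_assoc]

theorem pathComp_nil_left (i j : V) (x : Path i j →₀ k) :
    pathComp k i i j (Finsupp.single Path.nil 1) x = x := by
  induction x using Finsupp.induction_linear with
  | zero => simp
  | add x₁ x₂ h₁ h₂ => simp [h₁, h₂]
  | single p a => simp [pathComp_single]

theorem pathComp_nil_right (i j : V) (x : Path i j →₀ k) :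
    pathComp k i j j x (Finsupp.single Path.nil 1) = x := by
  induction x using Finsupp.induction_linear with
  | zero => simp
  | add x₁ x₂ h₁ h₂ => simp [h₁, h₂]
  | single p a => simp [pathComp_single]

variable (Q : BoundQuiver k V)

/-- The component `e_j (ρ) e_i` of the two-sided ideal of the path algebra generated by the
relations. -/
def relIdeal (i j : V) : Submodule k (Path i j →₀ k) :=
  Submodule.span k {y | ∃ (a b : V) (p : Path i a) (r : Path a b →₀ k) (q : Path b j),
    r ∈ Q.rels a b ∧
      y = pathComp k i b j (pathComp k i a b (Finsupp.single p 1) r) (Finsupp.single q 1)}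

theorem pathComp_mem_right (i j l : V) (x : Path i j →₀ k) {y : Path j l →₀ k}
    (hy : y ∈ Q.relIdeal j l) : pathComp k i j l x y ∈ Q.relIdeal i l := by
  induction x using Finsupp.induction_linear with
  | zero => simp
  | add x₁ x₂ h₁ h₂ => simpa using add_mem h₁ h₂
  | single s c =>
    induction hy using Submodule.span_induction with
    | mem y h =>
      obtain ⟨a, b, p, r, q, hr, rfl⟩ := h
      have e : (Finsupp.single s c : Path i j →₀ k) = c • Finsupp.single s 1 := by simp
      rw [e, map_smul, LinearMap.smul_apply]
      refine Submodule.smul_mem _ _ (Submodule.subset_span ⟨a, b, s.comp p, r, q, hr, ?_⟩)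
      rw [← pathComp_assoc, ← pathComp_assoc, pathComp_single, one_mul]
    | zero => simp
    | add y₁ y₂ _ _ h₁ h₂ => simpa using add_mem h₁ h₂
    | smul c y _ h => simpa using Submodule.smul_mem _ c h

theorem pathComp_mem_left (i j l : V) {x : Path i j →₀ k} (y : Path j l →₀ k)
    (hx : x ∈ Q.relIdeal i j) : pathComp k i j l x y ∈ Q.relIdeal i l := by
  induction y using Finsupp.induction_linear with
  | zero => simp
  | add x₁ x₂ h₁ h₂ => simpa using add_mem h₁ h₂
  | single s c =>
    induction hx using Submodule.span_induction with
    | mem y h =>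
      obtain ⟨a, b, p, r, q, hr, rfl⟩ := h
      have e : (Finsupp.single s c : Path j l →₀ k) = c • Finsupp.single s 1 := by simp
      rw [e, map_smul]
      refine Submodule.smul_mem _ _ (Submodule.subset_span ⟨a, b, p, r, q.comp s, hr, ?_⟩)
      rw [pathComp_assoc, pathComp_single, one_mul]
    | zero => simp
    | add y₁ y₂ _ _ h₁ h₂ => simpa using add_mem h₁ h₂
    | smul c y _ h => simpa using Submodule.smul_mem _ c h

/-! ### The algebra `Λ = kQ/(ρ)` -/

/-- `e_j Λ e_i`: linear combinations of paths from `i` to `j` modulo the relations. -/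
abbrev HomSpace (i j : V) : Type (max w u v) :=
  (Path i j →₀ k) ⧸ Q.relIdeal i j

/-- Composition of classes of paths, the left argument being travelled first. -/
def homComp (i j l : V) : Q.HomSpace i j →ₗ[k] Q.HomSpace j l →ₗ[k] Q.HomSpace i l :=
  ((Q.relIdeal j l).liftQ
    ((Q.relIdeal i j).liftQ ((pathComp k i j l).compr₂ (Q.relIdeal i l).mkQ) (by
      intro x hx
      rw [LinearMap.mem_ker]
      ext1 y
      exact LinearMap.ext fun c => by
        simpa using Q.pathComp_mem_left i j l (Finsupp.single y c) hx)).flip (by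
    intro y hy
    rw [LinearMap.mem_ker]
    refine LinearMap.ext fun x => ?_
    obtain ⟨x, rfl⟩ := Submodule.mkQ_surjective _ x
    simpa using Q.pathComp_mem_right i j l x hy)).flip

theorem homComp_mk (i j l : V) (x : Path i j →₀ k) (y : Path j l →₀ k) :
    Q.homComp i j l (Submodule.Quotient.mk x) (Submodule.Quotient.mk y) =
      Submodule.Quotient.mk (pathComp k i j l x y) := rfl

theorem homComp_assoc (i j l m : V) (x : Q.HomSpace i j) (y : Q.HomSpace j l)
    (z : Q.HomSpace l m) :
    Q.homComp i l m (Q.homComp i j l x y) z = Q.homComp i j m x (Q.homComp j l m y z) := by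
  obtain ⟨x, rfl⟩ := Submodule.Quotient.mk_surjective _ x
  obtain ⟨y, rfl⟩ := Submodule.Quotient.mk_surjective _ y
  obtain ⟨z, rfl⟩ := Submodule.Quotient.mk_surjective _ z
  simp only [homComp_mk, pathComp_assoc]

/-- The class of a path. -/
def pathClass {i j : V} (p : Path i j) : Q.HomSpace i j :=
  Submodule.Quotient.mk (Finsupp.single p 1)

theorem homComp_nil_left (i j : V) (x : Q.HomSpace i j) :
    Q.homComp i i j (Q.pathClass Path.nil) x = x := by
  obtain ⟨x, rfl⟩ := Submodule.Quotient.mk_surjective _ x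
  simp only [pathClass, homComp_mk, pathComp_nil_left]

theorem homComp_nil_right (i j : V) (x : Q.HomSpace i j) :
    Q.homComp i j j x (Q.pathClass Path.nil) = x := by
  obtain ⟨x, rfl⟩ := Submodule.Quotient.mk_surjective _ x
  simp only [pathClass, homComp_mk, pathComp_nil_right]

/-- The bound quiver algebra `Λ = kQ/(ρ) = ⨁ e_j Λ e_i`, for a finite set of vertices; the entry of
`x` at `i j` is `e_j x e_i`. -/
def PathAlg : Type (max w u v) := ∀ i j : V, Q.HomSpace i j

instance : AddCommGroup Q.PathAlg := inferInstanceAs (AddCommGroup (∀ i j : V, Q.HomSpace i j))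

instance : Module k Q.PathAlg := inferInstanceAs (Module k (∀ i j : V, Q.HomSpace i j))

open Classical in
/-- The image in `Λ` of a path. -/
def ofPath {i j : V} (p : Path i j) : Q.PathAlg :=
  Pi.single i (Pi.single j (Q.pathClass p))

/-- In `x * y` the paths of `y` are travelled first. -/
instance [Finite V] : Mul Q.PathAlg where
  mul x y := fun i j =>
    letI := Fintype.ofFinite V
    ∑ l : V, Q.homComp i l j (y i l) (x l j)

open Classical in
/-- The identity is the sum of the trivial paths. -/
instance : One Q.PathAlg where
  one := fun i j => if h : i = j then h ▸ Q.pathClass (Path.nil : Path i i) else 0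

theorem pathAlg_mul_apply [Fintype V] (x y : Q.PathAlg) (i j : V) :
    (x * y) i j = ∑ l : V, Q.homComp i l j (y i l) (x l j) := by
  have : Fintype.ofFinite V = ‹Fintype V› := Subsingleton.elim _ _
  rw [← this]
  rfl

theorem pathAlg_one_apply (i : V) : (1 : Q.PathAlg) i i = Q.pathClass Path.nil := by
  exact dif_pos rfl

theorem pathAlg_one_apply_ne {i j : V} (h : i ≠ j) : (1 : Q.PathAlg) i j = 0 :=
  dif_neg h

theorem pathAlg_add_apply (x y : Q.PathAlg) (i j : V) : (x + y) i j = x i j + y i j := rfl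

theorem pathAlg_smul_apply (c : k) (x : Q.PathAlg) (i j : V) : (c • x) i j = c • x i j := rfl

theorem pathAlg_zero_apply (i j : V) : (0 : Q.PathAlg) i j = 0 := rfl

instance [Finite V] : Ring Q.PathAlg :=
  letI := Fintype.ofFinite V
  { (inferInstance : AddCommGroup Q.PathAlg), (inferInstance : Mul Q.PathAlg),
    (inferInstance : One Q.PathAlg) with
    left_distrib := fun x y z => by
      funext i j
      simp only [pathAlg_mul_apply, pathAlg_add_apply, map_add, LinearMap.add_apply,
        Finset.sum_add_distrib]
    right_distrib := fun x y z => by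
      funext i j
      simp only [pathAlg_mul_apply, pathAlg_add_apply, map_add, Finset.sum_add_distrib]
    zero_mul := fun x => by
      funext i j
      simp only [pathAlg_mul_apply, pathAlg_zero_apply, map_zero, Finset.sum_const_zero]
    mul_zero := fun x => by
      funext i j
      simp only [pathAlg_mul_apply, pathAlg_zero_apply, map_zero, LinearMap.zero_apply,
        Finset.sum_const_zero]
    mul_assoc := fun x y z => by
      funext i j
      simp only [pathAlg_mul_apply, map_sum, LinearMap.sum_apply, homComp_assoc]
      exact Finset.sum_comm
    one_mul := fun x => by
      funext i j
      rw [pathAlg_mul_apply, Finset.sum_eq_single j, pathAlg_one_apply, homComp_nil_right]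
      · intro l _ h
        rw [pathAlg_one_apply_ne Q h, map_zero]
      · simp
    mul_one := fun x => by
      funext i j
      rw [pathAlg_mul_apply, Finset.sum_eq_single i, pathAlg_one_apply, homComp_nil_left]
      · intro l _ h
        rw [pathAlg_one_apply_ne Q h.symm, map_zero, LinearMap.zero_apply]
      · simp }

instance [Finite V] : Algebra k Q.PathAlg :=
  letI := Fintype.ofFinite V
  Algebra.ofModule
    (fun c x y => by
      funext i j
      simp only [pathAlg_mul_apply, pathAlg_smul_apply, map_smul, Finset.smul_sum])
    (fun c x y => by
      funext i j
      simp only [pathAlg_mul_apply, pathAlg_smul_apply, map_smul, LinearMap.smul_apply,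
        Finset.smul_sum])

/-- The part `Λ_t` of degree `t`, spanned by the paths of length `t`. -/
def degreePart (t : ℕ) : Submodule k Q.PathAlg :=
  Submodule.span k {x | ∃ (i j : V) (p : Path i j), p.length = t ∧ x = Q.ofPath p}

/-! ### Bound paths and `n`-homogeneous quivers -/

/-- A path is bound if its image in `kQ/(ρ)` is not zero. -/
def IsBoundPath {i j : V} (p : Path i j) : Prop :=
  (Finsupp.single p 1 : Path i j →₀ k) ∉ Q.relIdeal i j

/-- A bound path is maximal if no arrow prolongs it, at either end, to a bound path. -/
def IsMaximalBoundPath {i j : V} (p : Path i j) : Prop :=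
  Q.IsBoundPath p ∧ (∀ (l : V) (α : j ⟶ l), ¬ Q.IsBoundPath (p.comp α.toPath)) ∧
    ∀ (l : V) (α : l ⟶ i), ¬ Q.IsBoundPath (α.toPath.comp p)

/-- A bound quiver (its relations being homogeneous) is `n`-homogeneous if all its maximal bound
paths have length `n`. -/
def IsNHomogeneous (n : ℕ) : Prop :=
  ∀ (i j : V) (p : Path i j), Q.IsMaximalBoundPath p → p.length = n

/-- The `Λ`-bimodule `DΛ = Hom_k(Λ, k)` is generated by its part `DΛ_n`, which consists of the
functionals that vanish on `Λ_t` for all `t ≠ n`. -/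
def DualGeneratedBy (n : ℕ) [Finite V] : Prop :=
  Submodule.span k {f : Module.Dual k Q.PathAlg | ∃ (g : Module.Dual k Q.PathAlg)
    (a b : Q.PathAlg), (∀ t : ℕ, t ≠ n → ∀ x ∈ Q.degreePart t, g x = 0) ∧
      ∀ x : Q.PathAlg, f x = g (a * x * b)} = ⊤

/-! ### Stable `n`-translation quivers and complete `τ`-slices -/

/-- The bound quiver is a stable `n`-translation quiver with `n`-translation `τ`. -/
structure IsStableTranslation (n : ℕ) (τ : Equiv.Perm V) : Prop where
  /-- The algebra has Loewy length at most `n + 2`. -/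
  length_le : ∀ (i j : V) (p : Path i j), Q.IsBoundPath p → p.length ≤ n + 1
  /-- A maximal bound path has length `n + 1` and goes from `τ j` to `j` for some `j`. -/
  maximal : ∀ (i j : V) (p : Path i j), Q.IsMaximalBoundPath p → p.length = n + 1 ∧ i = τ j
  /-- Two bound paths of length `n + 1` from `τ i` to `i` have linearly dependent images. -/
  dependent : ∀ (i : V) (p q : Path (τ i) i), p.length = n + 1 → q.length = n + 1 →
    Q.IsBoundPath p → Q.IsBoundPath q → ∃ c : k, Q.pathClass p = c • Q.pathClass q
  /-- A bound element of degree `t ≤ n + 1` ending at `i` can be prolonged by a path starting at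
  `τ i` to a bound element of degree `n + 1`. -/
  prolong_left : ∀ (i j : V) (t : ℕ) (x : Path j i →₀ k), t ≤ n + 1 →
    (∀ p ∈ x.support, p.length = t) → x ∉ Q.relIdeal j i →
    ∃ q : Path (τ i) j, q.length + t = n + 1 ∧
      pathComp k (τ i) j i (Finsupp.single q 1) x ∉ Q.relIdeal (τ i) i
  /-- A bound element of degree `t ≤ n + 1` starting at `τ i` can be prolonged by a path ending at
  `i` to a bound element of degree `n + 1`. -/
  prolong_right : ∀ (i j : V) (t : ℕ) (x : Path (τ i) j →₀ k), t ≤ n + 1 →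
    (∀ p ∈ x.support, p.length = t) → x ∉ Q.relIdeal (τ i) j →
    ∃ q : Path j i, t + q.length = n + 1 ∧
      pathComp k (τ i) j i x (Finsupp.single q 1) ∉ Q.relIdeal (τ i) i

end BoundQuiver

/-- The full subquiver on a set of vertices. -/
def FullSub {V : Type u} (S : Set V) : Type u := {i : V // i ∈ S}

namespace FullSub

variable {V : Type u} [Quiver.{v} V] (S : Set V)

instance : Quiver.{v} (FullSub S) where
  Hom i j := i.1 ⟶ j.1

/-- The inclusion of the full subquiver. -/
def incl : FullSub S ⥤q V where
  obj i := i.1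
  map α := α

theorem length_mapPath {i j : FullSub S} (p : Path i j) :
    ((incl S).mapPath p).length = p.length := by
  induction p with
  | nil => rfl
  | cons p α h => simp [h]

theorem mapPath_injective {i j : FullSub S} :
    Function.Injective fun p : Path i j => (incl S).mapPath p := by
  intro p q h
  induction p with
  | nil =>
    have h' := congrArg Path.length h
    simp only [length_mapPath, Path.length_nil] at h'
    exact (Path.eq_nil_of_length_zero q h'.symm).symm
  | @cons b c p α ih =>
    cases q with
    | nil =>
      have h' := congrArg Path.length h
      simp [length_mapPath] at h'
    | @cons b' _ q β =>
      simp only [Prefunctor.mapPath_cons, Path.cons.injEq] at h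
      obtain ⟨hb, hp, hα⟩ := h
      obtain rfl : b = b' := Subtype.ext hb
      rw [ih (eq_of_heq hp), show α = β from eq_of_heq hα]

end FullSub

namespace BoundQuiver

variable {k : Type w} [Field k] {V : Type u} [Quiver.{v} V]

/-- The full subquiver on `S`, bound by the relations of `Q` between vertices of `S` (all paths
occurring in them run inside `S` when `S` is convex). -/
def restrict (Q : BoundQuiver k V) (S : Set V) : BoundQuiver k (FullSub S) where
  finite_arrows i j := Q.finite_arrows i.1 j.1
  rels i j := {r | r.mapDomain (fun p : Path i j => (FullSub.incl S).mapPath p) ∈ Q.rels i.1 j.1}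
  rels_homogeneous i j r hr := by
    obtain ⟨t, ht, h⟩ := Q.rels_homogeneous i.1 j.1 _ hr
    refine ⟨t, ht, fun p hp => ?_⟩
    rw [← FullSub.length_mapPath]
    apply h
    classical
    rw [Finsupp.mapDomain_support_of_injective (FullSub.mapPath_injective S)]
    exact Finset.mem_image_of_mem _ hp

end BoundQuiver

/-- The full subquiver on `S` is a complete `τ`-slice: it meets each `τ`-orbit in exactly one
vertex, and every vertex on a path between vertices of `S` is in `S`. -/
structure IsCompleteSlice {V : Type u} [Quiver.{v} V] (τ : Equiv.Perm V) (S : Set V) :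
    Prop where
  meets_orbit : ∀ i : V, ∃! j : V, j ∈ S ∧ τ.SameCycle i j
  convex : ∀ (i j l : V), Path i j → Path j l → i ∈ S → l ∈ S → j ∈ S

theorem IsCompleteSlice.finite {V : Type u} [Quiver.{v} V] {τ : Equiv.Perm V} {S : Set V}
    (h : IsCompleteSlice τ S) (hτ : Finite (Quotient (Equiv.Perm.SameCycle.setoid τ))) :
    Finite (FullSub S) := by
  refine Finite.of_injective
    (fun i : FullSub S => (Quotient.mk (Equiv.Perm.SameCycle.setoid τ) i.1)) ?_
  intro i j hij
  exact Subtype.ext ((h.meets_orbit i.1).unique ⟨i.2, Equiv.Perm.SameCycle.refl τ i.1⟩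
    ⟨j.2, Quotient.exact hij⟩)

/-- `Λ` is a `τ`-slice algebra, for the given `n`: it is isomorphic to the algebra defined by a
complete `τ`-slice of some acyclic stable `n`-translation quiver with finitely many `τ`-orbits. -/
def IsTauSliceAlgebra (k : Type w) [Field k] (n : ℕ) (A : Type*) [Ring A] [Algebra k A] : Prop :=
  ∃ (W : Type u') (_ : Quiver.{v'} W) (R : BoundQuiver k W) (τ : Equiv.Perm W)
    (hτ : Finite (Quotient (Equiv.Perm.SameCycle.setoid τ))) (S : Set W)
    (hS : IsCompleteSlice τ S),
    QuiverAcyclic W ∧ R.IsStableTranslation n τ ∧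
      (haveI := hS.finite hτ; Nonempty (A ≃ₐ[k] (R.restrict S).PathAlg))

end

/-! Write J for the span of the nilpotent elements of an algebra; for the algebra of an acyclic
bound quiver it is the span of the paths of positive length. Three conditions on Λ are shown to be
equivalent: (1) DΛ is generated by DΛ_n; (2) `Prolongs`: every nonzero homogeneous element can be
multiplied by paths on both sides to a nonzero element of degree n; (3) `SocleInPower`: J^(n+1) = 0,
and whatever J annihilates on both sides lies in J^n Λ. Condition (2) applied to a maximal bound
path forces n-homogeneity. Condition (3) does not mention the grading, so it crosses algebra
isomorphisms that need not respect path lengths. This is how information about a slice reaches the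
given presentation of Λ.

From slices to (2) (`IsStableTranslation.exists_prolong_in_slice`): prolong x : i → j to the left up
to τ j, which lies outside the slice. The path used must enter the slice by some arrow α, starting
at a vertex τ u. Keep only the piece from α onwards and prolong on the right up to u. The orbit of u
forces u into the slice, and deleting α leaves a nonzero prolongation of x of degree n inside the
slice.

From (2) to slices: the trivial extension Λ ⊕ DΛ is symmetric under the form that evaluates
functionals at 1. Place Λ_t in bidegree (0, t) and the functionals supported on Λ_s in bidegree (1,
n + 1 - s); the form then has bidegree (1, n + 1). Condition (2) makes this algebra generated in
second degree one, by the arrows and DΛ_n (`Prolongs.dualPart_succ_le`). Unrolling the first degree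
over ℤ gives a graded category on Q₀ × ℤ. Its quiver is acyclic; symmetry and nondegeneracy of the
form make it a stable n-translation quiver whose translation lowers the level by one. Its level zero
is a complete slice with algebra Λ. -/

noncomputable section

namespace BoundQuiver

variable {k : Type w} [Field k] {V : Type u} [Quiver.{v} V]

/-! ### Lengths of paths and the ideal of relations -/

/-- The linear combinations of paths of length `t`. -/
def homogeneous (k : Type w) [Field k] {V : Type u} [Quiver.{v} V] (i j : V) (t : ℕ) :
    Submodule k (Path i j →₀ k) :=
  Finsupp.supported k k {p | p.length = t}

theorem single_mem_homogeneous {i j : V} (p : Path i j) (c : k) :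
    Finsupp.single p c ∈ homogeneous k i j p.length :=
  Finsupp.single_mem_supported k c rfl

theorem homogeneous_eq_span (i j : V) (t : ℕ) :
    homogeneous k i j t =
      Submodule.span k ((fun p : Path i j => Finsupp.single p 1) '' {p | p.length = t}) :=
  Finsupp.supported_eq_span_single k _

@[elab_as_elim]
theorem homogeneous_induction {i j : V} {t : ℕ}
    {motive : (x : Path i j →₀ k) → x ∈ homogeneous k i j t → Prop}
    (single : ∀ (p : Path i j), p.length = t → ∀ hp, motive (Finsupp.single p 1) hp)
    (zero : motive 0 (zero_mem _))
    (add : ∀ x y hx hy, motive x hx → motive y hy → motive (x + y) (add_mem hx hy))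
    (smul : ∀ (c : k) (x) (hx), motive x hx → motive (c • x) (Submodule.smul_mem _ c hx))
    {x : Path i j →₀ k} (hx : x ∈ homogeneous k i j t) : motive x hx := by
  have key : ∃ h, motive x h := by
    have h := hx
    rw [homogeneous_eq_span] at h
    induction h using Submodule.span_induction with
    | mem x h =>
      obtain ⟨p, hp, rfl⟩ := h
      exact ⟨hx, single p hp hx⟩
    | zero => exact ⟨_, zero⟩
    | add x y hx' hy' h₁ h₂ =>
      rw [← homogeneous_eq_span] at hx' hy'
      obtain ⟨_, h₁⟩ := h₁ hx'
      obtain ⟨_, h₂⟩ := h₂ hy'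
      exact ⟨_, add x y _ _ h₁ h₂⟩
    | smul c x hx' h =>
      rw [← homogeneous_eq_span] at hx'
      obtain ⟨_, h⟩ := h hx'
      exact ⟨_, smul c x _ h⟩
  exact key.2

theorem pathComp_mem_homogeneous {i j l : V} {s t : ℕ} {x : Path i j →₀ k} {y : Path j l →₀ k}
    (hx : x ∈ homogeneous k i j s) (hy : y ∈ homogeneous k j l t) :
    pathComp k i j l x y ∈ homogeneous k i l (s + t) := by
  induction hx using homogeneous_induction with
  | zero => simp
  | add x₁ x₂ _ _ h₁ h₂ => simpa using add_mem h₁ h₂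
  | smul c x _ h => simpa using Submodule.smul_mem _ c h
  | single p hp =>
    induction hy using homogeneous_induction with
    | zero => simp
    | add x₁ x₂ _ _ h₁ h₂ => simpa using add_mem h₁ h₂
    | smul c x _ h => simpa using Submodule.smul_mem _ c h
    | single q hq =>
      rw [pathComp_single, ← hp, ← hq, ← Path.length_comp]
      exact single_mem_homogeneous _ _

open Classical in
/-- The part of a linear combination of paths which involves the paths of length `t`. -/
def lengthPart (k : Type w) [Field k] {V : Type u} [Quiver.{v} V] (i j : V) (t : ℕ) :
    (Path i j →₀ k) →ₗ[k] (Path i j →₀ k) :=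
  Finsupp.linearCombination k fun p => if p.length = t then Finsupp.single p 1 else 0

theorem lengthPart_single {i j : V} (t : ℕ) (p : Path i j) (c : k) :
    lengthPart k i j t (Finsupp.single p c) = if p.length = t then Finsupp.single p c else 0 := by
  rw [lengthPart, Finsupp.linearCombination_single]
  split_ifs <;> simp

theorem lengthPart_mem {i j : V} (t : ℕ) (x : Path i j →₀ k) :
    lengthPart k i j t x ∈ homogeneous k i j t := by
  induction x using Finsupp.induction_linear with
  | zero => simp
  | add x₁ x₂ h₁ h₂ => simpa using add_mem h₁ h₂
  | single p c =>
    rw [lengthPart_single]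
    split_ifs with h
    · exact h ▸ single_mem_homogeneous p c
    · exact zero_mem _

theorem lengthPart_of_mem {i j : V} {s t : ℕ} {x : Path i j →₀ k}
    (hx : x ∈ homogeneous k i j s) : lengthPart k i j t x = if s = t then x else 0 := by
  induction hx using homogeneous_induction with
  | zero => simp
  | add x₁ x₂ _ _ h₁ h₂ => rw [map_add, h₁, h₂]; split_ifs <;> simp
  | smul c x _ h => rw [map_smul, h]; split_ifs <;> simp
  | single p hp => rw [lengthPart_single, hp]

theorem exists_sum_lengthPart {i j : V} (x : Path i j →₀ k) :
    ∃ N : ℕ, ∑ t ∈ Finset.range N, lengthPart k i j t x = x := by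
  -- Asking for all large M lets the bounds of two summands be merged by taking their maximum.
  have key : ∃ N : ℕ, ∀ M, N ≤ M → ∑ t ∈ Finset.range M, lengthPart k i j t x = x := by
    induction x using Finsupp.induction_linear with
    | zero => exact ⟨0, by simp⟩
    | add x₁ x₂ h₁ h₂ =>
      obtain ⟨N₁, h₁⟩ := h₁
      obtain ⟨N₂, h₂⟩ := h₂
      refine ⟨max N₁ N₂, fun M hM => ?_⟩
      simp only [map_add, Finset.sum_add_distrib]
      rw [h₁ M (le_trans (le_max_left _ _) hM), h₂ M (le_trans (le_max_right _ _) hM)]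
    | single p c =>
      refine ⟨p.length + 1, fun M hM => ?_⟩
      simp only [lengthPart_single]
      rw [Finset.sum_ite_eq, if_pos (Finset.mem_range.2 hM)]
  obtain ⟨N, h⟩ := key
  exact ⟨N, h N le_rfl⟩

variable (Q : BoundQuiver k V)

-- A generator p r q is homogeneous of degree at least that of r, hence at least two. So homogeneous
-- members of the ideal already span it, which gives both the grading of Λ and the independence of
-- trivial paths and arrows modulo the relations.
@[elab_as_elim]
theorem relIdeal_induction {i j : V} {motive : (x : Path i j →₀ k) → x ∈ Q.relIdeal i j → Prop}
    (gen : ∀ (t : ℕ) (x : Path i j →₀ k), 2 ≤ t → x ∈ homogeneous k i j t →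
      ∀ hx : x ∈ Q.relIdeal i j, motive x hx) (zero : motive 0 (zero_mem _))
    (add : ∀ x y hx hy, motive x hx → motive y hy → motive (x + y) (add_mem hx hy))
    (smul : ∀ (c : k) (x) (hx), motive x hx → motive (c • x) (Submodule.smul_mem _ c hx))
    {x : Path i j →₀ k} (hx : x ∈ Q.relIdeal i j) : motive x hx := by
  induction hx using Submodule.span_induction with
  | mem x h =>
    have hx := Submodule.subset_span (R := k) h
    obtain ⟨a, b, p, r, q, hr, rfl⟩ := h
    obtain ⟨t, ht, h⟩ := Q.rels_homogeneous a b r hr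
    refine gen (p.length + t + q.length) _ (by omega) ?_ hx
    exact pathComp_mem_homogeneous (pathComp_mem_homogeneous (single_mem_homogeneous _ _) h)
      (single_mem_homogeneous _ _)
  | zero => exact zero
  | add x y hx hy h₁ h₂ => exact add x y hx hy h₁ h₂
  | smul c x hx h => exact smul c x hx h

theorem lengthPart_eq_zero_of_mem_relIdeal {i j : V} {t : ℕ} (ht : t < 2) {x : Path i j →₀ k}
    (hx : x ∈ Q.relIdeal i j) : lengthPart k i j t x = 0 := by
  induction hx using relIdeal_induction with
  | zero => simp
  | add x₁ x₂ _ _ h₁ h₂ => simp [h₁, h₂]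
  | smul c x _ h => simp [h]
  | gen s x hs hx h => rw [lengthPart_of_mem hx, if_neg (by omega)]

theorem isBoundPath_of_length_lt {i j : V} (p : Path i j) (hp : p.length < 2) :
    Q.IsBoundPath p := fun h => by
  have := Q.lengthPart_eq_zero_of_mem_relIdeal hp h
  simp [lengthPart_single] at this

theorem isBoundPath_iff {i j : V} (p : Path i j) : Q.IsBoundPath p ↔ Q.pathClass p ≠ 0 := by
  rw [IsBoundPath, pathClass, Ne, Submodule.Quotient.mk_eq_zero]

theorem homComp_pathClass {i j l : V} (p : Path i j) (q : Path j l) :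
    Q.homComp i j l (Q.pathClass p) (Q.pathClass q) = Q.pathClass (p.comp q) := by
  rw [pathClass, pathClass, homComp_mk, pathComp_single, one_mul, pathClass]

/-! ### Entries of elements of the bound quiver algebra -/

open Classical in
/-- The element of the algebra with only one nonzero entry. -/
def ofHom (i j : V) : Q.HomSpace i j →ₗ[k] Q.PathAlg :=
  (LinearMap.single k (fun i => ∀ j, Q.HomSpace i j) i ∘ₗ
    LinearMap.single k (fun j => Q.HomSpace i j) j :)

theorem ofPath_eq {i j : V} (p : Path i j) : Q.ofPath p = Q.ofHom i j (Q.pathClass p) := rfl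

/-- The entry of an element of the algebra, as a linear map. -/
def entry (i j : V) : Q.PathAlg →ₗ[k] Q.HomSpace i j where
  toFun x := x i j
  map_add' _ _ := rfl
  map_smul' _ _ := rfl

theorem entry_ofHom (i j : V) (x : Q.HomSpace i j) : Q.entry i j (Q.ofHom i j x) = x := by
  classical
  change (Pi.single i (Pi.single j x) : ∀ i j, Q.HomSpace i j) i j = x
  rw [Pi.single_eq_same, Pi.single_eq_same]

theorem entry_ofHom_left_ne {i j i' : V} (x : Q.HomSpace i j) (h : i' ≠ i) (j' : V) :
    Q.entry i' j' (Q.ofHom i j x) = 0 := by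
  classical
  change (Pi.single i (Pi.single j x) : ∀ i j, Q.HomSpace i j) i' j' = 0
  rw [Pi.single_eq_of_ne h]
  rfl

theorem entry_ofHom_right_ne {i j j' : V} (x : Q.HomSpace i j) (i' : V) (h : j' ≠ j) :
    Q.entry i' j' (Q.ofHom i j x) = 0 := by
  by_cases hi : i' = i
  · subst hi
    classical
    change (Pi.single i' (Pi.single j x) : ∀ i j, Q.HomSpace i j) i' j' = 0
    rw [Pi.single_eq_same, Pi.single_eq_of_ne h]
  · exact Q.entry_ofHom_left_ne x hi j'

theorem pathAlg_ext {x y : Q.PathAlg} (h : ∀ i j, Q.entry i j x = Q.entry i j y) : x = y :=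
  funext fun i => funext fun j => h i j

theorem entry_mul [Fintype V] (x y : Q.PathAlg) (i j : V) :
    Q.entry i j (x * y) = ∑ l : V, Q.homComp i l j (Q.entry i l y) (Q.entry l j x) :=
  Q.pathAlg_mul_apply x y i j

theorem entry_one (i : V) [Finite V] : Q.entry i i 1 = Q.pathClass Path.nil :=
  Q.pathAlg_one_apply i

theorem entry_one_of_ne {i j : V} [Finite V] (h : i ≠ j) : Q.entry i j 1 = 0 :=
  Q.pathAlg_one_apply_ne h

theorem sum_ofHom [Fintype V] (x : Q.PathAlg) : ∑ i, ∑ j, Q.ofHom i j (Q.entry i j x) = x := by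
  refine Q.pathAlg_ext fun i j => ?_
  rw [map_sum, Finset.sum_eq_single i, map_sum, Finset.sum_eq_single j, entry_ofHom]
  · intro l _ h
    exact Q.entry_ofHom_right_ne _ _ h.symm
  · simp
  · intro l _ h
    rw [map_sum]
    exact Finset.sum_eq_zero fun m _ => Q.entry_ofHom_left_ne _ h.symm _
  · simp

theorem ofHom_injective (i j : V) : Function.Injective (Q.ofHom i j) := fun x y h => by
  rw [← Q.entry_ofHom i j x, h, entry_ofHom]

theorem ofPath_mem {i j : V} (p : Path i j) : Q.ofPath p ∈ Q.degreePart p.length :=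
  Submodule.subset_span ⟨i, j, p, rfl, rfl⟩

@[elab_as_elim]
theorem homSpace_induction {i j : V} {motive : Q.HomSpace i j → Prop}
    (path : ∀ p : Path i j, motive (Q.pathClass p)) (zero : motive 0)
    (add : ∀ x y, motive x → motive y → motive (x + y))
    (smul : ∀ (c : k) (x), motive x → motive (c • x)) (x : Q.HomSpace i j) : motive x := by
  obtain ⟨x, rfl⟩ := Submodule.Quotient.mk_surjective _ x
  induction x using Finsupp.induction_linear with
  | zero => exact zero
  | add x₁ x₂ h₁ h₂ => rw [Submodule.Quotient.mk_add]; exact add _ _ h₁ h₂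
  | single p c =>
    have : (Finsupp.single p c : Path i j →₀ k) = c • Finsupp.single p 1 := by simp
    rw [this, Submodule.Quotient.mk_smul]
    exact smul _ _ (path p)

@[elab_as_elim]
theorem degreePart_induction {t : ℕ} {motive : (x : Q.PathAlg) → x ∈ Q.degreePart t → Prop}
    (path : ∀ (i j : V) (p : Path i j), p.length = t → ∀ hp, motive (Q.ofPath p) hp)
    (zero : motive 0 (zero_mem _))
    (add : ∀ x y hx hy, motive x hx → motive y hy → motive (x + y) (add_mem hx hy))
    (smul : ∀ (c : k) (x) (hx), motive x hx → motive (c • x) (Submodule.smul_mem _ c hx))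
    {x : Q.PathAlg} (hx : x ∈ Q.degreePart t) : motive x hx := by
  induction hx using Submodule.span_induction with
  | mem x h =>
    obtain ⟨i, j, p, hp, rfl⟩ := h
    exact path i j p hp _
  | zero => exact zero
  | add x y hx hy h₁ h₂ => exact add x y hx hy h₁ h₂
  | smul c x hx h => exact smul c x hx h

/-! ### Multiplication in Λ and its grading by path length -/

section Finite

variable [Finite V]

theorem ofHom_mul_ofHom {i j l : V} (x : Q.HomSpace i j) (y : Q.HomSpace j l) :
    Q.ofHom j l y * Q.ofHom i j x = Q.ofHom i l (Q.homComp i j l x y) := by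
  let := Fintype.ofFinite V
  refine Q.pathAlg_ext fun a b => ?_
  rw [entry_mul, Finset.sum_eq_single j]
  · by_cases ha : a = i
    · subst ha
      by_cases hb : b = l
      · subst hb
        rw [entry_ofHom, entry_ofHom, entry_ofHom]
      · rw [entry_ofHom_right_ne _ _ _ hb, entry_ofHom_right_ne _ _ _ hb, map_zero]
    · rw [entry_ofHom_left_ne _ _ ha, entry_ofHom_left_ne _ _ ha, map_zero, LinearMap.zero_apply]
  · intro m _ h
    rw [entry_ofHom_left_ne _ _ h, map_zero]
  · simp

theorem ofHom_mul_ofHom_of_ne {i j j' l : V} (x : Q.HomSpace i j) (y : Q.HomSpace j' l)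
    (h : j ≠ j') : Q.ofHom j' l y * Q.ofHom i j x = 0 := by
  let := Fintype.ofFinite V
  refine Q.pathAlg_ext fun a b => ?_
  rw [entry_mul, map_zero]
  refine Finset.sum_eq_zero fun m _ => ?_
  by_cases hm : m = j'
  · subst hm
    rw [entry_ofHom_right_ne _ _ _ h.symm, map_zero, LinearMap.zero_apply]
  · rw [entry_ofHom_left_ne _ _ hm, map_zero]

theorem ofPath_mul_ofPath {i j l : V} (p : Path i j) (q : Path j l) :
    Q.ofPath q * Q.ofPath p = Q.ofPath (p.comp q) := by
  rw [ofPath_eq, ofPath_eq, ofHom_mul_ofHom, homComp_pathClass, ofPath_eq]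

theorem ofPath_mul_ofPath_of_ne {i j j' l : V} (p : Path i j) (q : Path j' l) (h : j ≠ j') :
    Q.ofPath q * Q.ofPath p = 0 :=
  Q.ofHom_mul_ofHom_of_ne _ _ h

theorem ofPath_eq_zero_iff {i j : V} (p : Path i j) : Q.ofPath p = 0 ↔ ¬ Q.IsBoundPath p := by
  rw [isBoundPath_iff, not_not, ofPath_eq, map_eq_zero_iff _ (Q.ofHom_injective i j)]

theorem one_eq_sum [Fintype V] : (1 : Q.PathAlg) = ∑ i : V, Q.ofPath (Path.nil : Path i i) := by
  rw [← Q.sum_ofHom 1]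
  refine Finset.sum_congr rfl fun i _ => ?_
  rw [Finset.sum_eq_single i, entry_one, ofPath_eq]
  · intro j _ h
    rw [entry_one_of_ne Q h.symm, map_zero]
  · simp

theorem ofHom_mk_mem {i j : V} {t : ℕ} {x : Path i j →₀ k} (hx : x ∈ homogeneous k i j t) :
    Q.ofHom i j (Submodule.Quotient.mk x) ∈ Q.degreePart t := by
  induction hx using homogeneous_induction with
  | zero => simp
  | add x₁ x₂ _ _ h₁ h₂ => rw [Submodule.Quotient.mk_add, map_add]; exact add_mem h₁ h₂
  | smul c x _ h =>
    rw [Submodule.Quotient.mk_smul, map_smul]; exact Submodule.smul_mem _ c h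
  | single p hp => exact Submodule.subset_span ⟨i, j, p, hp, rfl⟩

/-- For a homogeneous member of the relation ideal the right-hand side is zero, so decomposing path
by path descends to the quotient. -/
theorem linearCombination_lof {i j : V} {t : ℕ} {x : Path i j →₀ k}
    (hx : x ∈ homogeneous k i j t) : (Finsupp.linearCombination k fun p : Path i j =>
      DirectSum.lof k ℕ (fun t => Q.degreePart t) p.length ⟨Q.ofPath p, Q.ofPath_mem p⟩) x =
      DirectSum.lof k ℕ (fun t => Q.degreePart t) t
        ⟨Q.ofHom i j (Submodule.Quotient.mk x), Q.ofHom_mk_mem hx⟩ := by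
  induction hx using homogeneous_induction with
  | single p hp =>
    subst hp
    rw [Finsupp.linearCombination_single, one_smul]
    rfl
  | zero =>
    rw [map_zero, ← map_zero (DirectSum.lof k ℕ (fun t => Q.degreePart t) t)]
    exact congrArg _ (Subtype.ext (by simp))
  | add x₁ x₂ hx₁ hx₂ h₁ h₂ =>
    rw [map_add, h₁, h₂, ← map_add]
    exact congrArg _ (Subtype.ext (by simp))
  | smul c x hx h =>
    rw [map_smul, h, ← map_smul]
    exact congrArg _ (Subtype.ext (by simp))

/-- The decomposition of an entry into its homogeneous parts. -/
def decomposeEntry (i j : V) : Q.HomSpace i j →ₗ[k] DirectSum ℕ fun t => Q.degreePart t :=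
  (Q.relIdeal i j).liftQ (Finsupp.linearCombination k fun p : Path i j =>
    DirectSum.lof k ℕ (fun t => Q.degreePart t) p.length ⟨Q.ofPath p, Q.ofPath_mem p⟩) (by
  intro x hx
  induction hx using relIdeal_induction with
  | zero => exact zero_mem _
  | add x₁ x₂ _ _ h₁ h₂ => exact add_mem h₁ h₂
  | smul c x _ h => exact Submodule.smul_mem _ c h
  | gen t x _ hx h =>
    rw [LinearMap.mem_ker, Q.linearCombination_lof hx]
    have : (⟨Q.ofHom i j (Submodule.Quotient.mk x), Q.ofHom_mk_mem hx⟩ : Q.degreePart t) = 0 := by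
      ext1
      change Q.ofHom i j (Submodule.Quotient.mk x) = 0
      rw [(Submodule.Quotient.mk_eq_zero _).2 h, map_zero]
    rw [this, map_zero])

theorem decomposeEntry_pathClass {i j : V} (p : Path i j) :
    Q.decomposeEntry i j (Q.pathClass p) =
      DirectSum.lof k ℕ (fun t => Q.degreePart t) p.length ⟨Q.ofPath p, Q.ofPath_mem p⟩ := by
  have : Q.decomposeEntry i j (Q.pathClass p) = (Finsupp.linearCombination k fun p : Path i j =>
    DirectSum.lof k ℕ (fun t => Q.degreePart t) p.length ⟨Q.ofPath p, Q.ofPath_mem p⟩)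
      (Finsupp.single p 1) := rfl
  rw [this, Finsupp.linearCombination_single, one_smul]

@[elab_as_elim]
theorem pathAlg_induction {motive : Q.PathAlg → Prop}
    (path : ∀ (i j : V) (p : Path i j), motive (Q.ofPath p)) (zero : motive 0)
    (add : ∀ x y, motive x → motive y → motive (x + y))
    (smul : ∀ (c : k) (x), motive x → motive (c • x)) (x : Q.PathAlg) : motive x := by
  let := Fintype.ofFinite V
  rw [← Q.sum_ofHom x]
  refine Finset.sum_induction _ _ add zero fun i _ => Finset.sum_induction _ _ add zero fun j _ => ?_
  generalize Q.entry i j x = y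
  induction y using homSpace_induction with
  | path p => exact path i j p
  | zero => rw [map_zero]; exact zero
  | add x y h₁ h₂ => rw [map_add]; exact add _ _ h₁ h₂
  | smul c x h => rw [map_smul]; exact smul _ _ h

/-- The decomposition of an element of the algebra into its homogeneous parts. -/
def decomposeHom [Fintype V] : Q.PathAlg →ₗ[k] DirectSum ℕ fun t => Q.degreePart t :=
  ∑ i, ∑ j, Q.decomposeEntry i j ∘ₗ Q.entry i j

theorem decomposeHom_ofPath [Fintype V] {i j : V} (p : Path i j) :
    Q.decomposeHom (Q.ofPath p) =
      DirectSum.lof k ℕ (fun t => Q.degreePart t) p.length ⟨Q.ofPath p, Q.ofPath_mem p⟩ := by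
  rw [decomposeHom, LinearMap.sum_apply, Finset.sum_eq_single i, LinearMap.sum_apply,
    Finset.sum_eq_single j, LinearMap.comp_apply]
  · rw [← Q.decomposeEntry_pathClass]
    exact congrArg _ (Q.entry_ofHom i j _)
  · intro l _ h
    rw [LinearMap.comp_apply, ofPath_eq, entry_ofHom_right_ne _ _ _ h, map_zero]
  · simp
  · intro l _ h
    rw [LinearMap.sum_apply]
    refine Finset.sum_eq_zero fun m _ => ?_
    rw [LinearMap.comp_apply, ofPath_eq, entry_ofHom_left_ne _ _ h, map_zero]
  · simp

theorem decomposeHom_of_mem [Fintype V] {t : ℕ} {x : Q.PathAlg} (hx : x ∈ Q.degreePart t) :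
    Q.decomposeHom x = DirectSum.lof k ℕ (fun t => Q.degreePart t) t ⟨x, hx⟩ := by
  induction hx using degreePart_induction with
  | path i j p hp =>
    subst hp
    exact Q.decomposeHom_ofPath p
  | zero =>
    rw [map_zero, ← map_zero (DirectSum.lof k ℕ (fun t => Q.degreePart t) t)]
    rfl
  | add x y hx hy h₁ h₂ =>
    rw [map_add, h₁, h₂, ← map_add]
    rfl
  | smul c x hx h =>
    rw [map_smul, h, ← map_smul]
    rfl

theorem coeLinearMap_decomposeHom [Fintype V] (x : Q.PathAlg) :
    DirectSum.coeLinearMap Q.degreePart (Q.decomposeHom x) = x := by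
  induction x using pathAlg_induction with
  | path i j p => rw [decomposeHom_ofPath, DirectSum.coeLinearMap_lof]
  | zero => simp
  | add x y h₁ h₂ => rw [map_add, map_add, h₁, h₂]
  | smul c x h => rw [map_smul, map_smul, h]

instance : DirectSum.Decomposition Q.degreePart :=
  let := Fintype.ofFinite V
  .ofLinearMap _ Q.decomposeHom (LinearMap.ext Q.coeLinearMap_decomposeHom)
    (DirectSum.linearMap_ext k fun t => LinearMap.ext fun x => by
      rw [LinearMap.comp_apply, LinearMap.comp_apply, DirectSum.coeLinearMap_lof,
        Q.decomposeHom_of_mem x.2]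
      rfl)

theorem one_mem_degreePart : (1 : Q.PathAlg) ∈ Q.degreePart 0 := by
  let := Fintype.ofFinite V
  rw [one_eq_sum]
  refine Submodule.sum_mem _ fun i _ => ?_
  have h := Q.ofPath_mem (Path.nil : Path i i)
  rwa [Path.length_nil] at h

theorem mul_mem_degreePart {s t : ℕ} {x y : Q.PathAlg} (hx : x ∈ Q.degreePart s)
    (hy : y ∈ Q.degreePart t) : x * y ∈ Q.degreePart (s + t) := by
  induction hx using degreePart_induction with
  | path i j p hp =>
    induction hy using degreePart_induction with
    | path i' j' q hq =>
      subst hp hq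
      by_cases hij : j' = i
      · subst hij
        rw [ofPath_mul_ofPath, add_comm, ← Path.length_comp]
        exact Q.ofPath_mem _
      · rw [ofPath_mul_ofPath_of_ne _ _ _ hij]
        exact zero_mem _
    | zero => rw [mul_zero]; exact zero_mem _
    | add x y _ _ h₁ h₂ => rw [mul_add]; exact add_mem h₁ h₂
    | smul c x _ h => rw [mul_smul_comm]; exact Submodule.smul_mem _ c h
  | zero => rw [zero_mul]; exact zero_mem _
  | add x y _ _ h₁ h₂ => rw [add_mul]; exact add_mem h₁ h₂
  | smul c x _ h => rw [smul_mul_assoc]; exact Submodule.smul_mem _ c h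

instance : SetLike.GradedMonoid Q.degreePart where
  one_mem := Q.one_mem_degreePart
  mul_mem _ _ _ _ hx hy := Q.mul_mem_degreePart hx hy

instance : GradedAlgebra Q.degreePart where

end Finite
end BoundQuiver

/-! ### A condition on algebras which characterises generation of the dual in degree `n` -/

/-- The span of the nilpotent elements of an algebra. -/
def nilSpan (k : Type*) [Field k] (A : Type*) [Ring A] [Algebra k A] : Submodule k A :=
  Submodule.span k {x | IsNilpotent x}

/-- The span `J` of the nilpotent elements satisfies `J ^ (n + 1) = 0`, and the elements annihilated
by `J` on both sides lie in the right ideal generated by `J ^ n`. -/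
def SocleInPower (k : Type*) [Field k] (A : Type*) [Ring A] [Algebra k A] (n : ℕ) : Prop :=
  nilSpan k A ^ (n + 1) = ⊥ ∧
    ∀ x : A, (∀ y ∈ nilSpan k A, y * x = 0 ∧ x * y = 0) → x ∈ nilSpan k A ^ n * ⊤

section Transfer

variable {k : Type*} [Field k] {A B : Type*} [Ring A] [Algebra k A] [Ring B] [Algebra k B]

theorem nilSpan_map (e : A ≃ₐ[k] B) : (nilSpan k A).map e.toLinearMap = nilSpan k B := by
  rw [nilSpan, Submodule.map_span]
  congr 1
  ext x
  constructor
  · rintro ⟨y, hy, rfl⟩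
    exact IsNilpotent.map hy e
  · intro hx
    exact ⟨e.symm x, IsNilpotent.map hx e.symm, e.apply_symm_apply x⟩

theorem SocleInPower.of_algEquiv {n : ℕ} (e : A ≃ₐ[k] B) (h : SocleInPower k A n) :
    SocleInPower k B n := by
  have hpow : ∀ m, (nilSpan k A ^ m).map e.toLinearMap = nilSpan k B ^ m := fun m => by
    rw [← nilSpan_map e]
    exact Submodule.map_pow _ e.toAlgHom m
  refine ⟨by rw [← hpow, h.1, Submodule.map_bot], fun x hx => ?_⟩
  have h' : e.symm x ∈ nilSpan k A ^ n * ⊤ := by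
    refine h.2 _ fun y hy => ?_
    have := hx (e y) (by rw [← nilSpan_map e]; exact Submodule.mem_map_of_mem hy)
    constructor
    · apply e.injective; simpa using this.1
    · apply e.injective; simpa using this.2
  have h'' : e (e.symm x) ∈ (nilSpan k A ^ n * ⊤).map e.toLinearMap :=
    Submodule.mem_map_of_mem h'
  rw [e.apply_symm_apply] at h''
  have h₃ : (nilSpan k A ^ n * ⊤).map e.toLinearMap =
      (nilSpan k A ^ n).map e.toLinearMap * (⊤ : Submodule k A).map e.toLinearMap :=
    Submodule.map_mul _ _ e.toAlgHom
  rw [h₃, hpow] at h''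
  exact Submodule.mul_le.2 (fun a ha b _ => Submodule.mul_mem_mul ha (Submodule.mem_top (x := b))) h''

end Transfer

/-! ### Prolongation to degree n, the socle, and generation of the dual -/

namespace BoundQuiver

variable {k : Type w} [Field k] {V : Type u} [Quiver.{v} V] [Finite V] (Q : BoundQuiver k V)

/-- Every nonzero homogeneous element can be multiplied by paths to a nonzero element of
degree `n`. -/
def Prolongs (n : ℕ) : Prop :=
  ∀ (s : ℕ) (x : Q.PathAlg), x ∈ Q.degreePart s → x ≠ 0 →
    ∃ (i j : V) (p : Path i j) (i' j' : V) (q : Path i' j'),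
      p.length + s + q.length = n ∧ Q.ofPath p * x * Q.ofPath q ≠ 0

theorem mul_mul_eq_zero {M : Type*} [AddCommGroup M] [Module k M] (g : Q.PathAlg →ₗ[k] M)
    (x : Q.PathAlg)
    (h : ∀ (i j : V) (p : Path i j) (i' j' : V) (q : Path i' j'),
      g (Q.ofPath p * x * Q.ofPath q) = 0) (a b : Q.PathAlg) : g (a * x * b) = 0 := by
  induction a using pathAlg_induction with
  | path i j p =>
    induction b using pathAlg_induction with
    | path i' j' q => exact h i j p i' j' q
    | zero => simp
    | add y z h₁ h₂ => rw [mul_add, map_add, h₁, h₂, add_zero]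
    | smul c y h => rw [mul_smul_comm, map_smul, h, smul_zero]
  | zero => simp
  | add y z h₁ h₂ => rw [add_mul, add_mul, map_add, h₁, h₂, add_zero]
  | smul c y h => rw [smul_mul_assoc, smul_mul_assoc, map_smul, h, smul_zero]

/-- If no product p x q of degree n survives, every generator y ↦ g (a y b) with g in DΛ_n vanishes
at x: expand a and b in paths, and note that g kills the products of other degrees. Then all
functionals vanish at x. -/
theorem DualGeneratedBy.prolongs {n : ℕ} (h : Q.DualGeneratedBy n) : Q.Prolongs n := by
  intro s x hx hx0
  by_contra! hcon
  apply hx0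
  rw [← Module.forall_dual_apply_eq_zero_iff k]
  intro f
  have hf : f ∈ LinearMap.ker (Module.Dual.eval k Q.PathAlg x) := by
    have htop : (⊤ : Submodule k (Module.Dual k Q.PathAlg)) ≤
        LinearMap.ker (Module.Dual.eval k Q.PathAlg x) := by
      rw [← h, Submodule.span_le]
      rintro f ⟨g, a, b, hg, hfg⟩
      change f x = 0
      rw [hfg]
      refine Q.mul_mul_eq_zero g x (fun i j p i' j' q => ?_) a b
      by_cases hn : p.length + s + q.length = n
      · rw [hcon i j p i' j' q hn, map_zero]
      · exact hg _ hn _ (Q.mul_mem_degreePart (Q.mul_mem_degreePart (Q.ofPath_mem p) hx)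
          (Q.ofPath_mem q))
    exact htop trivial
  exact hf

/-- Maximality lets only trivial paths multiply p to something nonzero, so the prolongation of
degree n is p itself. -/
theorem Prolongs.isNHomogeneous {n : ℕ} (h : Q.Prolongs n) : Q.IsNHomogeneous n := by
  intro i j p hp
  have hp0 : Q.ofPath p ≠ 0 := by
    rw [Ne, ofPath_eq_zero_iff, not_not]
    exact hp.1
  obtain ⟨a, b, r, a', b', q, hn, hne⟩ := h _ _ (Q.ofPath_mem p) hp0
  have ha : j = a := by
    by_contra hne'
    rw [ofPath_mul_ofPath_of_ne _ _ _ hne', zero_mul] at hne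
    exact hne rfl
  have hb : b' = i := by
    by_contra hne'
    rw [mul_assoc, ofPath_mul_ofPath_of_ne _ _ _ hne', mul_zero] at hne
    exact hne rfl
  subst ha hb
  have hr : r.length = 0 := by
    by_contra h0
    obtain ⟨m, hm⟩ := Nat.exists_eq_succ_of_ne_zero h0
    -- The arrow adjacent to p is the first arrow of r, whereas for q below it is the last one.
    obtain ⟨c, α, r', _, rfl⟩ := Path.eq_toPath_comp_of_length_eq_succ r hm
    rw [← ofPath_mul_ofPath, mul_assoc (Q.ofPath r'), ofPath_mul_ofPath,
      (Q.ofPath_eq_zero_iff _).2 (hp.2.1 c α), mul_zero, zero_mul] at hne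
    exact hne rfl
  have hq : q.length = 0 := by
    cases q with
    | nil => rfl
    | cons q' α =>
      rw [← Path.comp_toPath_eq_cons, ← ofPath_mul_ofPath, ← mul_assoc, mul_assoc (Q.ofPath r),
        ofPath_mul_ofPath, (Q.ofPath_eq_zero_iff _).2 (hp.2.2 _ α), mul_zero, zero_mul] at hne
      exact (hne rfl).elim
  omega

/-- The ideal spanned by the paths of positive length. -/
def arrowIdeal : Submodule k Q.PathAlg :=
  Submodule.span k {x | ∃ (i j : V) (p : Path i j), 0 < p.length ∧ x = Q.ofPath p}

theorem ofPath_mem_arrowIdeal {i j : V} (p : Path i j) (hp : 0 < p.length) :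
    Q.ofPath p ∈ Q.arrowIdeal :=
  Submodule.subset_span ⟨i, j, p, hp, rfl⟩

theorem degreePart_le_arrowIdeal {t : ℕ} (ht : 0 < t) : Q.degreePart t ≤ Q.arrowIdeal :=
  Submodule.span_mono fun _ ⟨i, j, p, hp, hx⟩ => ⟨i, j, p, hp ▸ ht, hx⟩

/-- The homogeneous part of degree `t` of an element. -/
abbrev part (t : ℕ) : Q.PathAlg →ₗ[k] Q.PathAlg := GradedAlgebra.proj Q.degreePart t

theorem part_mem (t : ℕ) (x : Q.PathAlg) : Q.part t x ∈ Q.degreePart t :=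
  SetLike.coe_mem _

theorem part_of_mem {t : ℕ} {x : Q.PathAlg} (hx : x ∈ Q.degreePart t) : Q.part t x = x := by
  rw [GradedAlgebra.proj_apply, DirectSum.decompose_of_mem_same _ hx]

theorem part_of_mem_ne {s t : ℕ} {x : Q.PathAlg} (hx : x ∈ Q.degreePart s) (h : s ≠ t) :
    Q.part t x = 0 := by
  rw [GradedAlgebra.proj_apply, DirectSum.decompose_of_mem_ne _ hx h]

theorem part_mul_left {s : ℕ} {x : Q.PathAlg} (hx : x ∈ Q.degreePart s) (t : ℕ)
    (y : Q.PathAlg) : Q.part (s + t) (x * y) = x * Q.part t y :=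
  DirectSum.coe_decompose_mul_add_of_left_mem _ hx

theorem part_mul_right {s : ℕ} {x : Q.PathAlg} (hx : x ∈ Q.degreePart s) (t : ℕ)
    (y : Q.PathAlg) : Q.part (t + s) (y * x) = Q.part t y * x :=
  DirectSum.coe_decompose_mul_add_of_right_mem _ hx

theorem mem_of_part_mem (U : Submodule k Q.PathAlg) {x : Q.PathAlg}
    (h : ∀ t, Q.part t x ∈ U) : x ∈ U := by
  classical
  rw [← DirectSum.sum_support_decompose Q.degreePart x]
  exact Submodule.sum_mem _ fun t _ => h t

theorem eq_part {s : ℕ} {x : Q.PathAlg} (h : ∀ t, t ≠ s → Q.part t x = 0) : x = Q.part s x := by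
  have : x - Q.part s x ∈ (⊥ : Submodule k Q.PathAlg) := by
    refine Q.mem_of_part_mem _ fun t => ?_
    rw [Submodule.mem_bot, map_sub]
    by_cases ht : t = s
    · subst ht
      rw [Q.part_of_mem (Q.part_mem t x), sub_self]
    · rw [h t ht, Q.part_of_mem_ne (Q.part_mem s x) (Ne.symm ht), sub_zero]
  rw [Submodule.mem_bot, sub_eq_zero] at this
  exact this

/-- Each of the m factors raises the degree by at least one. -/
theorem part_arrowIdeal_pow {m t : ℕ} (h : t < m) {x : Q.PathAlg}
    (hx : x ∈ Q.arrowIdeal ^ m) : Q.part t x = 0 := by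
  induction m generalizing t x with
  | zero => omega
  | succ m ih =>
    rw [pow_succ'] at hx
    induction hx using Submodule.mul_induction_on' with
    | mem_mul_mem y hy z hz =>
      induction hy using Submodule.span_induction with
      | mem y h =>
        obtain ⟨i, j, p, hp, rfl⟩ := h
        by_cases hpt : p.length ≤ t
        · obtain ⟨r, rfl⟩ := Nat.exists_eq_add_of_le hpt
          rw [Q.part_mul_left (Q.ofPath_mem p), ih (by omega) hz, mul_zero]
        · rw [GradedAlgebra.proj_apply,
            DirectSum.coe_decompose_mul_of_left_mem_of_not_le _ (Q.ofPath_mem p) hpt]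
      | zero => rw [zero_mul, map_zero]
      | add y z _ _ h₁ h₂ => rw [add_mul, map_add, h₁, h₂, add_zero]
      | smul c y _ h => rw [smul_mul_assoc, map_smul, h, smul_zero]
    | add y hy z hz h₁ h₂ => rw [map_add, h₁, h₂, add_zero]

theorem part_arrowIdeal_pow_mul_top {m t : ℕ} (h : t < m) {x : Q.PathAlg}
    (hx : x ∈ Q.arrowIdeal ^ m * ⊤) : Q.part t x = 0 := by
  induction hx using Submodule.mul_induction_on' with
  | mem_mul_mem y hy z hz =>
    clear hz
    induction z using pathAlg_induction with
    | path i j p =>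
      by_cases hpt : p.length ≤ t
      · obtain ⟨r, rfl⟩ := Nat.exists_eq_add_of_le' hpt
        rw [Q.part_mul_right (Q.ofPath_mem p), Q.part_arrowIdeal_pow (by omega) hy, zero_mul]
      · rw [GradedAlgebra.proj_apply,
          DirectSum.coe_decompose_mul_of_right_mem_of_not_le _ (Q.ofPath_mem p) hpt]
    | zero => rw [mul_zero, map_zero]
    | add y z h₁ h₂ => rw [mul_add, map_add, h₁, h₂, add_zero]
    | smul c y h => rw [mul_smul_comm, map_smul, h, smul_zero]
  | add y hy z hz h₁ h₂ => rw [map_add, h₁, h₂, add_zero]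

/-- Cutting a path into arrows gives m factors in J. The factor `⊤` absorbs the starting trivial
path and is essential for m = 0, because `arrowIdeal ^ 0` is only k · 1. -/
theorem degreePart_le_pow (m : ℕ) : Q.degreePart m ≤ Q.arrowIdeal ^ m * ⊤ := by
  induction m with
  | zero =>
    intro x _
    rw [pow_zero, one_mul]
    exact Submodule.mem_top
  | succ m ih =>
    intro x hx
    induction hx using degreePart_induction with
    | path i j p hp =>
      cases p with
      | nil => simp at hp
      | cons p α =>
        rw [← Path.comp_toPath_eq_cons, ← ofPath_mul_ofPath, pow_succ', mul_assoc]
        refine Submodule.mul_mem_mul (Q.ofPath_mem_arrowIdeal _ (by simp)) (ih ?_)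
        have : p.length = m := by simpa using hp
        exact this ▸ Q.ofPath_mem p
    | zero => exact zero_mem _
    | add x y _ _ h₁ h₂ => exact add_mem h₁ h₂
    | smul c x _ h => exact Submodule.smul_mem _ c h

/-- In degree zero the algebra is a product of copies of k, one for each vertex, and so has no
nonzero nilpotent elements. -/
theorem part_zero_eq_zero_of_isNilpotent {x : Q.PathAlg}
    (hx : IsNilpotent x) : Q.part 0 x = 0 := by
  -- For a grading by ℕ, projection to degree zero is a ring homomorphism.
  have h0 : IsNilpotent (Q.part 0 x) := hx.map (GradedRing.projZeroRingHom Q.degreePart)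
  have hmem := Q.part_mem 0 x
  generalize Q.part 0 x = y at h0 hmem
  have key : ∀ i : V, ∃ c : k, y * Q.ofPath (Path.nil : Path i i) =
      c • Q.ofPath (Path.nil : Path i i) := by
    intro i
    clear h0
    induction hmem using degreePart_induction with
    | path a b p hp =>
      by_cases ha : i = a
      · subst ha
        obtain rfl := Path.eq_of_length_zero p hp
        obtain rfl := Path.eq_nil_of_length_zero p hp
        exact ⟨1, by rw [ofPath_mul_ofPath, one_smul, Path.comp_nil]⟩
      · exact ⟨0, by rw [ofPath_mul_ofPath_of_ne _ _ _ ha, zero_smul]⟩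
    | zero => exact ⟨0, by simp⟩
    | add x y _ _ h₁ h₂ =>
      obtain ⟨c, h₁⟩ := h₁
      obtain ⟨d, h₂⟩ := h₂
      exact ⟨c + d, by rw [add_mul, h₁, h₂, add_smul]⟩
    | smul c x _ h =>
      obtain ⟨d, h⟩ := h
      exact ⟨c * d, by rw [smul_mul_assoc, h, mul_smul]⟩
  have hi : ∀ i : V, y * Q.ofPath (Path.nil : Path i i) = 0 := by
    intro i
    obtain ⟨c, hc⟩ := key i
    -- The trivial path at i is an eigenvector of left multiplication by y, so a vanishing power of
    -- y kills the eigenvalue c.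
    have hpow : ∀ m : ℕ, y ^ m * Q.ofPath (Path.nil : Path i i) =
        c ^ m • Q.ofPath (Path.nil : Path i i) := by
      intro m
      induction m with
      | zero => simp
      | succ m ih => rw [pow_succ, mul_assoc, hc, mul_smul_comm, ih, smul_smul, pow_succ']
    obtain ⟨m, hm⟩ := h0
    have h := hpow m
    rw [hm, zero_mul, eq_comm, smul_eq_zero, or_iff_left] at h
    · rw [hc, eq_zero_of_pow_eq_zero h, zero_smul]
    · rw [ofPath_eq_zero_iff, not_not]
      exact Q.isBoundPath_of_length_lt _ (by simp)
  let := Fintype.ofFinite V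
  rw [← mul_one y, one_eq_sum, Finset.mul_sum]
  exact Finset.sum_eq_zero fun i _ => hi i

/-- In an acyclic quiver a path of positive length cannot be composed with itself, so it squares to
zero; conversely, nilpotent elements have no component of degree zero. This describes the arrow
ideal without reference to the presentation. -/
theorem nilSpan_eq_arrowIdeal (hV : QuiverAcyclic V) : nilSpan k Q.PathAlg = Q.arrowIdeal := by
  apply le_antisymm
  · rw [nilSpan, Submodule.span_le]
    intro x hx
    refine Q.mem_of_part_mem _ fun t => ?_
    rcases Nat.eq_zero_or_pos t with rfl | ht
    · rw [Q.part_zero_eq_zero_of_isNilpotent hx]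
      exact zero_mem _
    · exact Q.degreePart_le_arrowIdeal ht (Q.part_mem t x)
  · refine Submodule.span_mono ?_
    rintro x ⟨i, j, p, hp, rfl⟩
    refine ⟨2, ?_⟩
    rw [pow_two, ofPath_mul_ofPath_of_ne]
    rintro rfl
    exact hp.ne' (hV _ p)

/-- No element has a component of degree above n, since it could not be prolonged to degree n. A
nonzero component of degree t ≠ n needs a path of positive length on one side to reach degree n,
which is impossible for an element annihilated by J; so such an element is concentrated in degree n.
-/
theorem Prolongs.socleInPower (hV : QuiverAcyclic V) {n : ℕ} (h : Q.Prolongs n) :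
    SocleInPower k Q.PathAlg n := by
  have hpart : ∀ (x : Q.PathAlg) (t : ℕ), n < t → Q.part t x = 0 := by
    intro x t ht
    by_contra hne
    obtain ⟨_, _, p, _, _, q, hn, _⟩ := h t _ (Q.part_mem t x) hne
    omega
  rw [SocleInPower, nilSpan_eq_arrowIdeal Q hV]
  refine ⟨?_, fun x hx => ?_⟩
  · rw [eq_bot_iff]
    intro x hx
    refine Q.mem_of_part_mem _ fun t => ?_
    rw [Submodule.mem_bot]
    by_cases ht : t < n + 1
    · exact Q.part_arrowIdeal_pow ht hx
    · exact hpart x t (by omega)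
  · have hx' : x = Q.part n x := by
      refine Q.eq_part fun t ht => ?_
      by_contra hne
      obtain ⟨_, _, p, _, _, q, hn, hpq⟩ := h t _ (Q.part_mem t x) hne
      apply hpq
      rcases Nat.eq_zero_or_pos p.length with hp | hp
      · have hq : 0 < q.length := by omega
        rw [mul_assoc, ← Q.part_mul_right (Q.ofPath_mem q),
          (hx _ (Q.ofPath_mem_arrowIdeal q hq)).2, map_zero, mul_zero]
      · rw [← Q.part_mul_left (Q.ofPath_mem p), (hx _ (Q.ofPath_mem_arrowIdeal p hp)).1, map_zero,
          zero_mul]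
    rw [hx']
    exact Q.degreePart_le_pow n (Q.part_mem n x)

/-! ### Finiteness of acyclic bound quivers -/

theorem wellFounded_arrows (hV : QuiverAcyclic V) :
    WellFounded fun i j : V => ∃ p : Path i j, 0 < p.length := by
  have : IsTrans V fun i j : V => ∃ p : Path i j, 0 < p.length :=
    ⟨fun i j l ⟨p, hp⟩ ⟨q, _⟩ => ⟨p.comp q, by rw [Path.length_comp]; omega⟩⟩
  have : Std.Irrefl fun i j : V => ∃ p : Path i j, 0 < p.length :=
    ⟨fun i ⟨p, hp⟩ => hp.ne' (hV i p)⟩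
  exact Finite.wellFounded_of_trans_of_irrefl _

-- A path is trivial or a path to an earlier vertex followed by an arrow, so well-founded induction
-- on the target applies.
include Q in
theorem finite_path (hV : QuiverAcyclic V) (i j : V) : Finite (Path i j) := by
  induction j using (wellFounded_arrows hV).induction with
  | h j ih =>
    have : ∀ l : V, Finite (Path i l × (l ⟶ j)) := by
      intro l
      -- The induction hypothesis is available at l only if an arrow l → j exists; otherwise the
      -- product is empty.
      rcases isEmpty_or_nonempty (l ⟶ j) with h | ⟨⟨α⟩⟩
      · infer_instance
      · have := ih l ⟨α.toPath, by simp⟩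
        have := Q.finite_arrows l j
        infer_instance
    have hs : Function.Surjective (fun x : PLift (i = j) ⊕ Σ l : V, Path i l × (l ⟶ j) =>
        (match x with
        | .inl h => h.down ▸ Path.nil
        | .inr ⟨_, p, α⟩ => p.cons α : Path i j)) := by
      intro p
      cases p with
      | nil => exact ⟨.inl ⟨rfl⟩, rfl⟩
      | cons p α => exact ⟨.inr ⟨_, p, α⟩, rfl⟩
    exact Finite.of_surjective _ hs

theorem finiteDimensional (hV : QuiverAcyclic V) : FiniteDimensional k Q.PathAlg := by
  have : ∀ i j : V, FiniteDimensional k (Q.HomSpace i j) := fun i j => by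
    have := Q.finite_path hV i j
    infer_instance
  exact Module.Finite.pi (M := fun i => ∀ j : V, Q.HomSpace i j)

/-- Were the span of the generators proper, finite dimension would provide x ≠ 0 at which all of
them vanish. A product p x q ≠ 0 with p and q of maximal total length is annihilated by J on both
sides, hence concentrated in degree n. Yet composing the degree n part of y ↦ p y q with any
functional gives a generator, so this product has no degree n part. -/
theorem dualGeneratedBy_of_socleInPower (hV : QuiverAcyclic V) {n : ℕ}
    (h : SocleInPower k Q.PathAlg n) : Q.DualGeneratedBy n := by
  have := Q.finiteDimensional hV
  rw [SocleInPower, nilSpan_eq_arrowIdeal Q hV] at h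
  have hbig : ∀ t, n < t → Q.degreePart t = ⊥ := by
    intro t ht
    obtain ⟨r, rfl⟩ := Nat.exists_eq_add_of_lt ht
    have h' := Q.degreePart_le_pow (n + r + 1)
    rwa [show n + r + 1 = (n + 1) + r by omega, pow_add, h.1, Submodule.bot_mul,
      Submodule.bot_mul, le_bot_iff, show (n + 1) + r = n + r + 1 by omega] at h'
  by_contra hne
  obtain ⟨F, hF, hker⟩ := Submodule.exists_le_ker_of_lt_top _ (lt_top_iff_ne_top.2 hne)
  obtain ⟨x, rfl⟩ := (Module.evalEquiv k Q.PathAlg).surjective F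
  have hx : x ≠ 0 := by
    rintro rfl
    exact hF (map_zero _)
  -- The total lengths of the pairs p, q with p x q ≠ 0; the maximum of this set yields a socle
  -- element.
  let T : Set ℕ := {m | ∃ (i j : V) (p : Path i j) (i' j' : V) (q : Path i' j'),
    p.length + q.length = m ∧ Q.ofPath p * x * Q.ofPath q ≠ 0}
  have hT : T.Nonempty := by
    by_contra hempty
    apply hx
    have := Q.mul_mul_eq_zero LinearMap.id x (fun i j p i' j' q => by
      by_contra hpq
      exact hempty ⟨_, i, j, p, i', j', q, rfl, hpq⟩) 1 1
    simpa using this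
  have hzero : ∀ {i j : V} (p : Path i j), n < p.length → Q.ofPath p = 0 := fun p hp => by
    have := Q.ofPath_mem p
    rwa [hbig _ hp, Submodule.mem_bot] at this
  have hbdd : BddAbove T := by
    -- Each of the two paths has length at most n, because Λ vanishes above degree n.
    refine ⟨n + n, ?_⟩
    rintro m ⟨i, j, p, i', j', q, rfl, hpq⟩
    by_contra hlt
    apply hpq
    by_cases hp : n < p.length
    · rw [hzero p hp, zero_mul, zero_mul]
    · rw [hzero q (by omega), mul_zero]
  obtain ⟨i, j, p, i', j', q, hm, hpq⟩ := Nat.sSup_mem hT hbdd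
  have hmax : ∀ {a b : V} (r : Path a b) {a' b' : V} (s : Path a' b'),
      p.length + q.length < r.length + s.length → Q.ofPath r * x * Q.ofPath s = 0 := by
    intro a b r a' b' s hlt
    by_contra hrs
    have := le_csSup hbdd (show _ ∈ T from ⟨a, b, r, a', b', s, rfl, hrs⟩)
    omega
  have hsoc := h.2 (Q.ofPath p * x * Q.ofPath q) (by
    intro y hy
    induction hy using Submodule.span_induction with
    | mem y h =>
      obtain ⟨a, b, r, hr, rfl⟩ := h
      constructor
      · by_cases hja : j = a
        · subst hja
          rw [← mul_assoc, ← mul_assoc, ofPath_mul_ofPath]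
          exact hmax _ _ (by rw [Path.length_comp]; omega)
        · rw [← mul_assoc, ← mul_assoc, ofPath_mul_ofPath_of_ne _ _ _ hja, zero_mul, zero_mul]
      · by_cases hja : b = i'
        · subst hja
          rw [mul_assoc, ofPath_mul_ofPath]
          exact hmax _ _ (by rw [Path.length_comp]; omega)
        · rw [mul_assoc, ofPath_mul_ofPath_of_ne _ _ _ hja, mul_zero]
    | zero => simp
    | add y z _ _ h₁ h₂ =>
      rw [add_mul, mul_add, h₁.1, h₁.2, h₂.1, h₂.2]
      simp
    | smul c y _ h =>
      rw [smul_mul_assoc, mul_smul_comm, h.1, h.2]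
      simp)
  -- Components below degree n vanish since the product lies in J^n Λ, those above since J^(n+1) =
  -- 0.
  have hpart : Q.part n (Q.ofPath p * x * Q.ofPath q) ≠ 0 := by
    rwa [← Q.eq_part]
    intro t ht
    rcases lt_or_gt_of_ne ht with ht | ht
    · exact Q.part_arrowIdeal_pow_mul_top ht hsoc
    · have := Q.part_mem t (Q.ofPath p * x * Q.ofPath q)
      rwa [hbig t ht, Submodule.mem_bot] at this
  apply hpart
  rw [← Module.forall_dual_apply_eq_zero_iff k]
  intro g
  have hmem : (g ∘ₗ Q.part n ∘ₗ LinearMap.mulRight k (Q.ofPath q) ∘ₗ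
      LinearMap.mulLeft k (Q.ofPath p) : Module.Dual k Q.PathAlg) ∈
      LinearMap.ker (Module.evalEquiv k Q.PathAlg x) := by
    refine hker (Submodule.subset_span
      ⟨g ∘ₗ Q.part n, Q.ofPath p, Q.ofPath q, fun t ht y hy => ?_, fun z => rfl⟩)
    rw [LinearMap.comp_apply, Q.part_of_mem_ne hy ht, map_zero]
  exact hmem

end BoundQuiver

/-! ### Full subquivers on convex sets of vertices -/

namespace FullSub

variable {V : Type u} [Quiver.{v} V] {S : Set V}

/-- The image of a path of a full subquiver. -/
def inclPath {i j : FullSub S} (p : Path i j) : Path i.1 j.1 := (incl S).mapPath p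

theorem length_inclPath {i j : FullSub S} (p : Path i j) : (inclPath p).length = p.length :=
  length_mapPath S p

theorem inclPath_comp {i j l : FullSub S} (p : Path i j) (q : Path j l) :
    inclPath (p.comp q) = (inclPath p).comp (inclPath q) :=
  Prefunctor.mapPath_comp _ p q

theorem exists_inclPath_eq (hS : ∀ i j l : V, Path i j → Path j l → i ∈ S → l ∈ S → j ∈ S)
    {i j : FullSub S} (p : Path i.1 j.1) : ∃ p' : Path i j, inclPath p' = p := by
  -- Induction runs over the path in V, so the end point must be a vertex of V together with a
  -- membership proof.
  have key : ∀ {b : V} (hb : b ∈ S) (p : Path i.1 b),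
      ∃ p' : Path i (show FullSub S from ⟨b, hb⟩), inclPath p' = p := by
    intro b hb p
    induction p with
    | nil => exact ⟨Path.nil, rfl⟩
    | @cons b c p α ih =>
      obtain ⟨p', hp'⟩ := ih (hS i.1 b c p α.toPath i.2 hb)
      exact ⟨p'.cons (c := show FullSub S from ⟨c, hb⟩) α,
        congrArg (fun r => Path.cons r α) hp'⟩
  exact key j.2 p

theorem quiverAcyclic (hV : QuiverAcyclic V) : QuiverAcyclic (FullSub S) := fun i p => by
  rw [← length_inclPath]
  exact hV _ _

variable (k : Type w) [Field k]

/-- The inclusion of linear combinations of paths of a full subquiver. -/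
def inclMap (i j : FullSub S) : (Path i j →₀ k) →ₗ[k] (Path i.1 j.1 →₀ k) :=
  Finsupp.lmapDomain k k fun p : Path i j => inclPath p

theorem inclMap_single {i j : FullSub S} (p : Path i j) (c : k) :
    inclMap k i j (Finsupp.single p c) = Finsupp.single (inclPath p) c :=
  Finsupp.mapDomain_single

theorem inclMap_injective (i j : FullSub S) : Function.Injective (inclMap k i j) :=
  Finsupp.mapDomain_injective (mapPath_injective S)

theorem inclMap_surjective (hS : ∀ i j l : V, Path i j → Path j l → i ∈ S → l ∈ S → j ∈ S)
    (i j : FullSub S) : Function.Surjective (inclMap k i j) := by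
  intro x
  induction x using Finsupp.induction_linear with
  | zero => exact ⟨0, map_zero _⟩
  | add x y h₁ h₂ =>
    obtain ⟨x, rfl⟩ := h₁
    obtain ⟨y, rfl⟩ := h₂
    exact ⟨x + y, map_add _ _ _⟩
  | single p c =>
    obtain ⟨p', rfl⟩ := exists_inclPath_eq hS p
    exact ⟨Finsupp.single p' c, inclMap_single k p' c⟩

theorem inclMap_pathComp (i j l : FullSub S) (x : Path i j →₀ k) (y : Path j l →₀ k) :
    inclMap k i l (BoundQuiver.pathComp k i j l x y) =
      BoundQuiver.pathComp k i.1 j.1 l.1 (inclMap k i j x) (inclMap k j l y) := by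
  induction x using Finsupp.induction_linear with
  | zero => simp
  | add x₁ x₂ h₁ h₂ => simp [h₁, h₂]
  | single p a =>
    induction y using Finsupp.induction_linear with
    | zero => simp
    | add y₁ y₂ h₁ h₂ => simp [h₁, h₂]
    | single q b =>
      rw [BoundQuiver.pathComp_single, inclMap_single, inclMap_single, inclMap_single,
        BoundQuiver.pathComp_single, inclPath_comp]

theorem inclMap_mem_homogeneous {i j : FullSub S} {t : ℕ} {x : Path i j →₀ k}
    (hx : x ∈ BoundQuiver.homogeneous k i j t) :
    inclMap k i j x ∈ BoundQuiver.homogeneous k i.1 j.1 t := by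
  induction hx using BoundQuiver.homogeneous_induction with
  | single p hp =>
    rw [inclMap_single, ← hp, ← length_inclPath]
    exact BoundQuiver.single_mem_homogeneous _ _
  | zero => rw [map_zero]; exact zero_mem _
  | add x y _ _ h₁ h₂ => rw [map_add]; exact add_mem h₁ h₂
  | smul c x _ h => rw [map_smul]; exact Submodule.smul_mem _ c h

end FullSub

namespace BoundQuiver

variable {k : Type w} [Field k] {V : Type u} [Quiver.{v} V] (Q : BoundQuiver k V)

-- Convexity is what makes the two ideals agree: a generator p r q of the big ideal between vertices
-- of S involves only paths that run inside S.
open FullSub in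
theorem mem_restrict_relIdeal {S : Set V}
    (hS : ∀ i j l : V, Path i j → Path j l → i ∈ S → l ∈ S → j ∈ S) {i j : FullSub S}
    (x : Path i j →₀ k) :
    x ∈ (Q.restrict S).relIdeal i j ↔ inclMap k i j x ∈ Q.relIdeal i.1 j.1 := by
  constructor
  · intro hx
    induction hx using Submodule.span_induction with
    | mem x h =>
      obtain ⟨a, b, p, r, q, hr, rfl⟩ := h
      refine Submodule.subset_span ⟨a.1, b.1, inclPath p, inclMap k a b r, inclPath q, hr, ?_⟩
      rw [inclMap_pathComp, inclMap_pathComp, inclMap_single, inclMap_single]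
    | zero => rw [map_zero]; exact zero_mem _
    | add x y _ _ h₁ h₂ => rw [map_add]; exact add_mem h₁ h₂
    | smul c x _ h => rw [map_smul]; exact Submodule.smul_mem _ c h
  · have key : ∀ y ∈ Q.relIdeal i.1 j.1, ∃ z ∈ (Q.restrict S).relIdeal i j,
        inclMap k i j z = y := by
      intro y hy
      induction hy using Submodule.span_induction with
      | mem y h =>
        obtain ⟨a, b, p, r, q, hr, rfl⟩ := h
        -- A path in the support of r joins its end points, which puts them on a path between
        -- vertices of S; for r = 0 they may lie outside S.
        by_cases hr0 : r = 0
        · exact ⟨0, zero_mem _, by simp [hr0]⟩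
        obtain ⟨s, hs⟩ := Finsupp.support_nonempty_iff.2 hr0
        have ha : a ∈ S := hS i.1 a j.1 p (s.comp q) i.2 j.2
        have hb : b ∈ S := hS i.1 b j.1 (p.comp s) q i.2 j.2
        obtain ⟨a, rfl⟩ : ∃ a' : FullSub S, a'.1 = a := ⟨⟨a, ha⟩, rfl⟩
        obtain ⟨b, rfl⟩ : ∃ b' : FullSub S, b'.1 = b := ⟨⟨b, hb⟩, rfl⟩
        obtain ⟨p, rfl⟩ := exists_inclPath_eq hS p
        obtain ⟨q, rfl⟩ := exists_inclPath_eq hS q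
        obtain ⟨r, rfl⟩ := inclMap_surjective k hS a b r
        refine ⟨_, Submodule.subset_span ⟨_, _, p, r, q, hr, rfl⟩, ?_⟩
        rw [inclMap_pathComp, inclMap_pathComp, inclMap_single, inclMap_single]
      | zero => exact ⟨0, zero_mem _, map_zero _⟩
      | add x y _ _ h₁ h₂ =>
        obtain ⟨z₁, hz₁, h₁⟩ := h₁
        obtain ⟨z₂, hz₂, h₂⟩ := h₂
        exact ⟨z₁ + z₂, add_mem hz₁ hz₂, by rw [map_add, h₁, h₂]⟩
      | smul c x _ h =>
        obtain ⟨z, hz, h⟩ := h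
        exact ⟨c • z, Submodule.smul_mem _ c hz, by rw [map_smul, h]⟩
    intro hx
    obtain ⟨z, hz, h⟩ := key _ hx
    rwa [← inclMap_injective k i j h]

/-! ### Products with a single entry -/

section Finite

variable [Finite V]

theorem entry_ofHom_mul {j b : V} (u : Q.HomSpace j b) (x : Q.PathAlg) (a : V) :
    Q.entry a b (Q.ofHom j b u * x) = Q.homComp a j b (Q.entry a j x) u := by
  let := Fintype.ofFinite V
  rw [entry_mul, Finset.sum_eq_single j, entry_ofHom]
  · intro l _ h
    rw [entry_ofHom_left_ne _ _ h, map_zero]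
  · simp

theorem entry_mul_ofHom {a i : V} (u : Q.HomSpace a i) (x : Q.PathAlg) (b : V) :
    Q.entry a b (x * Q.ofHom a i u) = Q.homComp a i b u (Q.entry i b x) := by
  let := Fintype.ofFinite V
  rw [entry_mul, Finset.sum_eq_single i, entry_ofHom]
  · intro l _ h
    rw [entry_ofHom_right_ne _ _ _ h, map_zero, LinearMap.zero_apply]
  · simp

theorem exists_mk_eq_entry {t : ℕ} {x : Q.PathAlg} (hx : x ∈ Q.degreePart t) (i j : V) :
    ∃ y ∈ homogeneous k i j t, Q.entry i j x = Submodule.Quotient.mk y := by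
  induction hx using degreePart_induction with
  | path a b p hp =>
    by_cases ha : i = a
    · subst ha
      by_cases hb : j = b
      · subst hb
        exact ⟨Finsupp.single p 1, hp ▸ single_mem_homogeneous p 1, Q.entry_ofHom i j _⟩
      · exact ⟨0, zero_mem _, Q.entry_ofHom_right_ne _ _ hb⟩
    · exact ⟨0, zero_mem _, Q.entry_ofHom_left_ne _ ha _⟩
  | zero => exact ⟨0, zero_mem _, by rw [map_zero, Submodule.Quotient.mk_zero]⟩
  | add x y _ _ h₁ h₂ =>
    obtain ⟨z₁, hz₁, h₁⟩ := h₁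
    obtain ⟨z₂, hz₂, h₂⟩ := h₂
    exact ⟨z₁ + z₂, add_mem hz₁ hz₂, by rw [map_add, h₁, h₂, Submodule.Quotient.mk_add]⟩
  | smul c x _ h =>
    obtain ⟨z, hz, h⟩ := h
    exact ⟨c • z, Submodule.smul_mem _ c hz, by rw [map_smul, h, Submodule.Quotient.mk_smul]⟩

theorem prolongs_of_homogeneous {n : ℕ}
    (h : ∀ (s : ℕ) (i j : V) (x : Path i j →₀ k), x ∈ homogeneous k i j s →
      x ∉ Q.relIdeal i j → ∃ (a b : V) (q : Path a i) (p : Path j b), p.length + s + q.length = n ∧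
        pathComp k a j b (pathComp k a i j (Finsupp.single q 1) x) (Finsupp.single p 1) ∉
          Q.relIdeal a b) : Q.Prolongs n := by
  intro s x hx hx0
  obtain ⟨i, j, hij⟩ : ∃ i j, Q.entry i j x ≠ 0 := by
    by_contra! hcon
    exact hx0 (Q.pathAlg_ext fun i j => by rw [hcon, map_zero])
  obtain ⟨y, hy, hxy⟩ := Q.exists_mk_eq_entry hx i j
  have hy0 : y ∉ Q.relIdeal i j := by
    rwa [hxy, Ne, Submodule.Quotient.mk_eq_zero] at hij
  obtain ⟨a, b, q, p, hn, hne⟩ := h s i j y hy hy0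
  refine ⟨j, b, p, a, i, q, hn, fun h0 => hne ?_⟩
  have h1 := congrArg (Q.entry a b) h0
  rw [ofPath_eq, ofPath_eq, entry_mul_ofHom, entry_ofHom_mul, hxy, map_zero, pathClass, pathClass,
    homComp_mk, homComp_mk, Submodule.Quotient.mk_eq_zero] at h1
  rwa [pathComp_assoc]

end Finite

/-! ### Complete slices of stable translation quivers -/

/-- Walking back from i, some step must leave S. -/
theorem exists_arrow_entering {S : Set V} {a i : V} (ha : a ∉ S) (hi : i ∈ S) (q : Path a i) :
    ∃ (b c : V) (q₁ : Path a b) (α : b ⟶ c) (q₂ : Path c i),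
      b ∉ S ∧ c ∈ S ∧ q = (q₁.comp α.toPath).comp q₂ := by
  induction q with
  | nil => exact (ha hi).elim
  | @cons c d q β ih =>
    by_cases hc : c ∈ S
    · obtain ⟨b, c', q₁, α, q₂, hb, hc', rfl⟩ := ih hc
      exact ⟨b, c', q₁, α, q₂.cons β, hb, hc', rfl⟩
    · exact ⟨c, d, q, β, Path.nil, hc, hi, rfl⟩

variable {Q}

theorem IsStableTranslation.nonempty_path {n : ℕ} {τ : Equiv.Perm V}
    (h : Q.IsStableTranslation n τ) (i : V) : Nonempty (Path (τ i) i) := by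
  obtain ⟨q, _⟩ := h.prolong_left i i 0 (Finsupp.single Path.nil 1) (by omega)
    (single_mem_homogeneous (Path.nil : Path i i) (1 : k)) (Q.isBoundPath_of_length_lt _ (by simp))
  exact ⟨q⟩

theorem IsStableTranslation.nonempty_path_pow {n : ℕ} {τ : Equiv.Perm V}
    (h : Q.IsStableTranslation n τ) (m : ℕ) (i : V) : Nonempty (Path ((τ ^ m) i) i) := by
  induction m with
  | zero => exact ⟨Path.nil⟩
  | succ m ih =>
    obtain ⟨p⟩ := ih
    obtain ⟨q⟩ := h.nonempty_path ((τ ^ m) i)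
    refine ⟨?_⟩
    rw [pow_succ', Equiv.Perm.mul_apply]
    exact q.comp p

/-- There are paths from τ^m y to y for all m ≥ 0. If the representative of the orbit in S were τ^m
s with m > 0, the walk τ^m s → τ s → v would put τ s in S by convexity. So it is τ^(-r) s with r ≥
0, and s lies on the walk v → s → τ^(-r) s between vertices of S. -/
theorem IsStableTranslation.mem_slice {n : ℕ} {τ : Equiv.Perm V} (h : Q.IsStableTranslation n τ)
    {S : Set V} (hS : IsCompleteSlice τ S) {s v : V} (α : τ s ⟶ v) (hv : v ∈ S) (hs : τ s ∉ S)
    (p : Path v s) : s ∈ S := by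
  obtain ⟨s', ⟨hs', m, rfl⟩, _⟩ := hS.meets_orbit s
  obtain ⟨r, rfl | rfl⟩ := m.eq_nat_or_neg
  · rcases r with _ | r
    · simpa using hs'
    · obtain ⟨q⟩ := h.nonempty_path_pow r (τ s)
      refine (hs (hS.convex _ _ _ q α.toPath ?_ hv)).elim
      rw [← Equiv.Perm.mul_apply, ← pow_succ, ← zpow_natCast]
      exact hs'
  · obtain ⟨q⟩ := h.nonempty_path_pow r ((τ ^ (-(r : ℤ))) s)
    rw [← Equiv.Perm.mul_apply, zpow_neg, zpow_natCast, mul_inv_cancel, Equiv.Perm.one_apply] at q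
    rw [zpow_neg, zpow_natCast] at hs'
    exact hS.convex _ _ _ p q hv hs'

/-- Prolongations to degree n + 1 exist in the whole quiver but leave the slice. Shifting the window
of length n + 1 so that it starts with the arrow α entering the slice puts everything after α inside
the slice, and what follows α has degree n. -/
theorem IsStableTranslation.exists_prolong_in_slice {n : ℕ} {τ : Equiv.Perm V}
    (hV : QuiverAcyclic V) (h : Q.IsStableTranslation n τ) {S : Set V} (hS : IsCompleteSlice τ S)
    {s : ℕ} {i j : V} (hi : i ∈ S) (hj : j ∈ S) {x : Path i j →₀ k}
    (hx : x ∈ homogeneous k i j s) (hx0 : x ∉ Q.relIdeal i j) :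
    ∃ (a b : V) (_ : a ∈ S) (_ : b ∈ S) (q : Path a i) (p : Path j b),
      p.length + s + q.length = n ∧
        pathComp k a j b (pathComp k a i j (Finsupp.single q 1) x) (Finsupp.single p 1) ∉
          Q.relIdeal a b := by
  have hxne : x ≠ 0 := by
    rintro rfl
    exact hx0 (zero_mem _)
  obtain ⟨x₀, hx₀⟩ := Finsupp.support_nonempty_iff.2 hxne
  have hs : s ≤ n + 1 := by
    obtain ⟨p, hp, hb⟩ : ∃ p : Path i j, p.length = s ∧ Q.IsBoundPath p := by
      by_contra! hcon
      apply hx0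
      clear hx0 hxne hx₀
      induction hx using homogeneous_induction with
      | single p hp => exact not_not.1 (hcon p hp)
      | zero => exact zero_mem _
      | add x y _ _ h₁ h₂ => exact add_mem h₁ h₂
      | smul c x _ h => exact Submodule.smul_mem _ c h
    exact hp ▸ h.length_le _ _ p hb
  obtain ⟨q, hq, hqx⟩ := h.prolong_left j i s x hs hx hx0
  -- Two vertices of S in one orbit coincide, so τ j in S would make q followed by a path in x a
  -- cycle of length n + 1 > 0.
  have hτ : τ j ∉ S := by
    intro hτ
    have : τ j = j := (hS.meets_orbit j).unique ⟨hτ, 1, by simp⟩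
      ⟨hj, Equiv.Perm.SameCycle.refl τ j⟩
    have h0 : ∀ r : Path (τ j) j, r.length = 0 := by
      rw [this]
      exact hV j
    have := h0 (q.comp x₀)
    have hl := hx hx₀
    change x₀.length = s at hl
    rw [Path.length_comp] at this
    omega
  obtain ⟨u, c, q₁, α, q₂, hu, hc, rfl⟩ := exists_arrow_entering hτ hi q
  -- Writing the source of α as τ u is what allows a prolongation on the right, ending at u.
  obtain ⟨u, rfl⟩ := τ.surjective u
  have hz : pathComp k (τ u) c j (Finsupp.single α.toPath 1)
      (pathComp k c i j (Finsupp.single q₂ 1) x) ∉ Q.relIdeal (τ u) j := by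
    intro hmem
    apply hqx
    have := Q.pathComp_mem_right (τ j) (τ u) j (Finsupp.single q₁ 1) hmem
    rwa [← pathComp_assoc, ← pathComp_assoc, pathComp_single, pathComp_single, one_mul,
      one_mul] at this
  have hlen : 1 + (q₂.length + s) ≤ n + 1 := by
    simp only [Path.length_comp, Path.length_toPath] at hq
    omega
  obtain ⟨p, hp, hzp⟩ := h.prolong_right u j (1 + (q₂.length + s)) _ hlen
    (pathComp_mem_homogeneous (single_mem_homogeneous α.toPath (1 : k))
      (pathComp_mem_homogeneous (single_mem_homogeneous q₂ (1 : k)) hx)) hz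
  have hu' : u ∈ S := h.mem_slice hS α hc hu ((q₂.comp x₀).comp p)
  -- Dropping α lowers the degree from n + 1 to n and keeps the element nonzero, since multiplying
  -- it by α gives a nonzero element.
  refine ⟨c, u, hc, hu', q₂, p, by omega, fun hmem => hzp ?_⟩
  rw [pathComp_assoc]
  exact Q.pathComp_mem_right _ _ _ _ hmem

open FullSub in
theorem IsStableTranslation.prolongs_restrict {n : ℕ} {τ : Equiv.Perm V}
    (hV : QuiverAcyclic V) (h : Q.IsStableTranslation n τ) {S : Set V} (hS : IsCompleteSlice τ S)
    [Finite (FullSub S)] : (Q.restrict S).Prolongs n := by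
  refine prolongs_of_homogeneous _ fun s i j x hx hx0 => ?_
  rw [Q.mem_restrict_relIdeal hS.convex] at hx0
  obtain ⟨a, b, ha, hb, q, p, hn, hne⟩ :=
    h.exists_prolong_in_slice hV hS i.2 j.2 (inclMap_mem_homogeneous k hx) hx0
  obtain ⟨a, rfl⟩ : ∃ a' : FullSub S, a'.1 = a := ⟨⟨a, ha⟩, rfl⟩
  obtain ⟨b, rfl⟩ : ∃ b' : FullSub S, b'.1 = b := ⟨⟨b, hb⟩, rfl⟩
  obtain ⟨q, rfl⟩ := exists_inclPath_eq hS.convex q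
  obtain ⟨p, rfl⟩ := exists_inclPath_eq hS.convex p
  rw [length_inclPath, length_inclPath] at hn
  refine ⟨a, b, q, p, hn, ?_⟩
  rw [Q.mem_restrict_relIdeal hS.convex, inclMap_pathComp, inclMap_pathComp, inclMap_single,
    inclMap_single]
  exact hne

end BoundQuiver

/-- Prolongation holds for the length grading of the slice, which A does not see; only its
grading-free form is carried over to A. -/
theorem IsTauSliceAlgebra.socleInPower {k : Type w} [Field k] {n : ℕ} {A : Type*} [Ring A]
    [Algebra k A] (h : IsTauSliceAlgebra.{w, u', v'} k n A) : SocleInPower k A n := by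
  obtain ⟨W, _, R, τ, hτ, S, hS, hW, hR, ⟨e⟩⟩ := h
  have := hS.finite hτ
  exact ((hR.prolongs_restrict hW hS).socleInPower _ (FullSub.quiverAcyclic hW)).of_algEquiv e.symm

/-! ### Presentations of graded categories generated in degree one -/

/-- A graded `k`-linear category with set of objects `W`, its morphisms being elements of an
algebra `E`, which is generated in degree one, with trivial part of degree zero; the arrows of the
quiver `W` index bases of its spaces of morphisms of degree one. -/
structure GradedHoms (k : Type w) [Field k] (W : Type u') [Quiver.{v'} W] (E : Type*) [Ring E]
    [Algebra k E] where
  idem : W → E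
  hom : W → W → ℕ → Submodule k E
  finite : ∀ a b : W, Finite (a ⟶ b)
  basis : ∀ a b : W, Module.Basis (a ⟶ b) k (hom a b 1)
  idem_ne_zero : ∀ a, idem a ≠ 0
  hom_zero : ∀ a, hom a a 0 = Submodule.span k {idem a}
  hom_zero_of_ne : ∀ a b, a ≠ b → hom a b 0 = ⊥
  idem_mul : ∀ {a b t x}, x ∈ hom a b t → idem b * x = x
  mul_idem : ∀ {a b t x}, x ∈ hom a b t → x * idem a = x
  mul_mem : ∀ {a b c t x y}, x ∈ hom b c 1 → y ∈ hom a b t → x * y ∈ hom a c (t + 1)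
  hom_succ_le : ∀ a b t, hom a b (t + 1) ≤ ⨆ c, hom c b 1 * hom a c t
  independent : ∀ (a b) (s : Finset ℕ) (x : ℕ → E), (∀ t, x t ∈ hom a b t) →
    ∑ t ∈ s, x t = 0 → ∀ t ∈ s, x t = 0

namespace GradedHoms

variable {k : Type w} [Field k] {W : Type u'} [Quiver.{v'} W] {E : Type*} [Ring E] [Algebra k E]
  (C : GradedHoms k W E)

/-- The morphism given by a path. -/
def val {a : W} : ∀ {b : W}, Path a b → E
  | _, .nil => C.idem a
  | _, .cons p α => (C.basis _ _ α : E) * val p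

theorem val_mem {a b : W} (p : Path a b) : C.val p ∈ C.hom a b p.length := by
  induction p with
  | nil =>
    rw [Path.length_nil, C.hom_zero]
    exact Submodule.subset_span rfl
  | cons p α ih => exact C.mul_mem (SetLike.coe_mem _) ih

theorem val_comp {a b c : W} (p : Path a b) (q : Path b c) :
    C.val (p.comp q) = C.val q * C.val p := by
  induction q with
  | nil => exact (C.idem_mul (C.val_mem p)).symm
  | cons q α ih =>
    rw [Path.comp_cons, val, val, ih, mul_assoc]

theorem val_toPath {a b : W} (α : a ⟶ b) : C.val α.toPath = C.basis a b α :=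
  C.mul_idem (SetLike.coe_mem _)

/-- Generation in degree one is iterated, each factor of degree one being expanded in the basis
given by the arrows. -/
theorem hom_le_span (a b : W) (t : ℕ) :
    C.hom a b t ≤ Submodule.span k {x | ∃ p : Path a b, p.length = t ∧ C.val p = x} := by
  induction t generalizing b with
  | zero =>
    by_cases h : a = b
    · subst h
      rw [C.hom_zero, Submodule.span_singleton_le_iff_mem]
      exact Submodule.subset_span ⟨Path.nil, rfl, rfl⟩
    · rw [C.hom_zero_of_ne a b h]
      exact bot_le
  | succ t ih =>
    refine (C.hom_succ_le a b t).trans (iSup_le fun c => Submodule.mul_le.2 fun x hx y hy => ?_)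
    have hx' : x ∈ Submodule.span k (Set.range fun α => (C.basis c b α : E)) := by
      have h := congrArg (Submodule.map (C.hom c b 1).subtype) (C.basis c b).span_eq
      rw [Submodule.map_span, ← Set.range_comp, Submodule.map_top, Submodule.range_subtype] at h
      exact h.ge hx
    have hy' := ih c hy
    clear hx hy
    induction hx' using Submodule.span_induction with
    | mem x h =>
      obtain ⟨α, rfl⟩ := h
      induction hy' using Submodule.span_induction with
      | mem y h =>
        obtain ⟨p, hp, rfl⟩ := h
        exact Submodule.subset_span ⟨p.cons α, by rw [Path.length_cons, hp], rfl⟩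
      | zero => rw [mul_zero]; exact zero_mem _
      | add y z _ _ h₁ h₂ => rw [mul_add]; exact add_mem h₁ h₂
      | smul r y _ h => rw [mul_smul_comm]; exact Submodule.smul_mem _ r h
    | zero => rw [zero_mul]; exact zero_mem _
    | add y z _ _ h₁ h₂ => rw [add_mul]; exact add_mem h₁ h₂
    | smul r y _ h => rw [smul_mul_assoc]; exact Submodule.smul_mem _ r h

/-- The morphism given by a linear combination of paths. -/
def eval (a b : W) : (Path a b →₀ k) →ₗ[k] E :=
  Finsupp.linearCombination k fun p : Path a b => C.val p

theorem eval_single {a b : W} (p : Path a b) (c : k) :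
    C.eval a b (Finsupp.single p c) = c • C.val p :=
  Finsupp.linearCombination_single _ _ _

theorem eval_pathComp (a b c : W) (x : Path a b →₀ k) (y : Path b c →₀ k) :
    C.eval a c (BoundQuiver.pathComp k a b c x y) = C.eval b c y * C.eval a b x := by
  induction x using Finsupp.induction_linear with
  | zero => simp
  | add x₁ x₂ h₁ h₂ => simp [h₁, h₂, mul_add]
  | single p r =>
    induction y using Finsupp.induction_linear with
    | zero => simp
    | add y₁ y₂ h₁ h₂ => simp [h₁, h₂, add_mul]
    | single q s =>
      rw [BoundQuiver.pathComp_single, eval_single, eval_single, eval_single, val_comp,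
        smul_mul_smul_comm, mul_comm r s]

theorem eval_mem {a b : W} {t : ℕ} {x : Path a b →₀ k}
    (hx : x ∈ BoundQuiver.homogeneous k a b t) : C.eval a b x ∈ C.hom a b t := by
  induction hx using BoundQuiver.homogeneous_induction with
  | single p hp =>
    rw [eval_single, one_smul, ← hp]
    exact C.val_mem p
  | zero => rw [map_zero]; exact zero_mem _
  | add x y _ _ h₁ h₂ => rw [map_add]; exact add_mem h₁ h₂
  | smul c x _ h => rw [map_smul]; exact Submodule.smul_mem _ c h

theorem exists_eval_eq {a b : W} {t : ℕ} {x : E} (hx : x ∈ C.hom a b t) :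
    ∃ y ∈ BoundQuiver.homogeneous k a b t, C.eval a b y = x := by
  have h := C.hom_le_span a b t hx
  clear hx
  induction h using Submodule.span_induction with
  | mem x h =>
    obtain ⟨p, rfl, rfl⟩ := h
    exact ⟨_, BoundQuiver.single_mem_homogeneous p 1, by rw [eval_single, one_smul]⟩
  | zero => exact ⟨0, zero_mem _, map_zero _⟩
  | add x y _ _ h₁ h₂ =>
    obtain ⟨z₁, hz₁, rfl⟩ := h₁
    obtain ⟨z₂, hz₂, rfl⟩ := h₂
    exact ⟨z₁ + z₂, add_mem hz₁ hz₂, map_add _ _ _⟩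
  | smul c x _ h =>
    obtain ⟨z, hz, rfl⟩ := h
    exact ⟨c • z, Submodule.smul_mem _ c hz, map_smul _ _ _⟩

/-- The bound quiver which presents a graded category. -/
def boundQuiver : BoundQuiver k W where
  finite_arrows := C.finite
  rels a b := {r | C.eval a b r = 0 ∧ ∃ t : ℕ, 2 ≤ t ∧ ∀ p ∈ r.support, p.length = t}
  rels_homogeneous _ _ _ hr := hr.2

/-- In degree zero only the trivial path occurs, and its value is a nonzero idempotent; in degree
one the arrows go to a basis. -/
theorem eq_zero_of_eval_eq_zero {a b : W} {t : ℕ} (ht : t < 2) {x : Path a b →₀ k}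
    (hx : x ∈ BoundQuiver.homogeneous k a b t) (h0 : C.eval a b x = 0) : x = 0 := by
  obtain rfl | rfl : t = 0 ∨ t = 1 := by omega
  · by_cases h : a = b
    · subst h
      have key : ∃ c : k, x = Finsupp.single Path.nil c := by
        clear h0
        induction hx using BoundQuiver.homogeneous_induction with
        | single p hp => exact ⟨1, by rw [Path.eq_nil_of_length_zero p hp]⟩
        | zero => exact ⟨0, by simp⟩
        | add x y _ _ h₁ h₂ =>
          obtain ⟨c, rfl⟩ := h₁
          obtain ⟨d, rfl⟩ := h₂
          exact ⟨c + d, by rw [Finsupp.single_add]⟩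
        | smul c x _ h =>
          obtain ⟨d, rfl⟩ := h
          exact ⟨c * d, by rw [Finsupp.smul_single, smul_eq_mul]⟩
      obtain ⟨c, rfl⟩ := key
      rw [eval_single, smul_eq_zero, or_iff_left
        (show C.val (Path.nil : Path a a) ≠ 0 from C.idem_ne_zero a)] at h0
      rw [h0, Finsupp.single_zero]
    · clear h0
      induction hx using BoundQuiver.homogeneous_induction with
      | single p hp => exact (h (Path.eq_of_length_zero p hp)).elim
      | zero => rfl
      | add x y _ _ h₁ h₂ => rw [h₁, h₂, add_zero]
      | smul c x _ h => rw [h, smul_zero]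
  · have key : ∃ y : (a ⟶ b) →₀ k, x = Finsupp.lmapDomain k k Hom.toPath y := by
      clear h0
      induction hx using BoundQuiver.homogeneous_induction with
      | single p hp =>
        cases p with
        | nil => simp at hp
        | cons p α =>
          have hp' : p.length = 0 := by simpa using hp
          obtain rfl := Path.eq_of_length_zero p hp'
          obtain rfl := Path.eq_nil_of_length_zero p hp'
          exact ⟨Finsupp.single α 1, by
            rw [Finsupp.lmapDomain_apply, Finsupp.mapDomain_single]; rfl⟩
      | zero => exact ⟨0, by simp⟩
      | add x y _ _ h₁ h₂ =>
        obtain ⟨c, rfl⟩ := h₁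
        obtain ⟨d, rfl⟩ := h₂
        exact ⟨c + d, by rw [map_add]⟩
      | smul c x _ h =>
        obtain ⟨d, rfl⟩ := h
        exact ⟨c • d, by rw [map_smul]⟩
    obtain ⟨y, rfl⟩ := key
    have hy : C.eval a b (Finsupp.lmapDomain k k Hom.toPath y) =
        (Finsupp.linearCombination k (C.basis a b) y : C.hom a b 1) := by
      clear h0 hx
      induction y using Finsupp.induction_linear with
      | zero => simp
      | add y₁ y₂ h₁ h₂ => rw [map_add, map_add, map_add, h₁, h₂, Submodule.coe_add]
      | single α c =>
        rw [Finsupp.lmapDomain_apply, Finsupp.mapDomain_single, eval_single, val_toPath,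
          Finsupp.linearCombination_single]
        rfl
    have hy0 : Finsupp.linearCombination k (C.basis a b) y = 0 :=
      Subtype.ext (hy.symm.trans h0)
    rw [(C.basis a b).linearIndependent.finsuppLinearCombination_injective
      (hy0.trans (map_zero _).symm), map_zero]

/-- Independence of the degrees makes the kernel of evaluation homogeneous. Its components of degree
below two are zero, and those of higher degree are relations by definition of `boundQuiver`. -/
theorem mem_relIdeal_iff {a b : W} (x : Path a b →₀ k) :
    x ∈ C.boundQuiver.relIdeal a b ↔ C.eval a b x = 0 := by
  constructor
  · intro hx
    induction hx using Submodule.span_induction with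
    | mem x h =>
      obtain ⟨c, d, p, r, q, hr, rfl⟩ := h
      rw [eval_pathComp, eval_pathComp, hr.1, zero_mul, mul_zero]
    | zero => exact map_zero _
    | add x y _ _ h₁ h₂ => rw [map_add, h₁, h₂, add_zero]
    | smul c x _ h => rw [map_smul, h, smul_zero]
  · intro hx
    obtain ⟨N, hN⟩ := BoundQuiver.exists_sum_lengthPart x
    have h0 : ∀ t ∈ Finset.range N, C.eval a b (BoundQuiver.lengthPart k a b t x) = 0 := by
      refine C.independent a b _ (fun t => C.eval a b (BoundQuiver.lengthPart k a b t x))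
        (fun t => C.eval_mem (BoundQuiver.lengthPart_mem t x)) ?_
      rw [← map_sum, hN, hx]
    rw [← hN]
    refine Submodule.sum_mem _ fun t ht => ?_
    by_cases h2 : t < 2
    · rw [C.eq_zero_of_eval_eq_zero h2 (BoundQuiver.lengthPart_mem t x) (h0 t ht)]
      exact zero_mem _
    · refine Submodule.subset_span ⟨a, b, Path.nil, BoundQuiver.lengthPart k a b t x, Path.nil,
        ⟨h0 t ht, t, by omega, BoundQuiver.lengthPart_mem t x⟩, ?_⟩
      rw [BoundQuiver.pathComp_nil_left, BoundQuiver.pathComp_nil_right]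

end GradedHoms

/-! ### Stable translation quivers from Frobenius forms -/

namespace GradedHoms

variable {k : Type w} [Field k] {W : Type u'} [Quiver.{v'} W] {E : Type*} [Ring E] [Algebra k E]
  (C : GradedHoms k W E)

theorem isBoundPath_iff {a b : W} (p : Path a b) : C.boundQuiver.IsBoundPath p ↔ C.val p ≠ 0 := by
  rw [BoundQuiver.IsBoundPath, mem_relIdeal_iff, eval_single, one_smul]

/-- Paths span the morphisms of each degree, so a witness for nonvanishing may be taken to be a
path. -/
theorem exists_path_mul_ne_zero {a b : W} {t : ℕ} {M : Type*} [AddCommGroup M] [Module k M]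
    (f : E →ₗ[k] M) {y : E} (hy : y ∈ C.hom a b t) (h : f y ≠ 0) :
    ∃ q : Path a b, q.length = t ∧ f (C.val q) ≠ 0 := by
  by_contra! hcon
  apply h
  obtain ⟨z, hz, rfl⟩ := C.exists_eval_eq hy
  clear hy h
  induction hz using BoundQuiver.homogeneous_induction with
  | single p hp => rw [eval_single, one_smul, hcon p hp]
  | zero => simp
  | add x y _ _ h₁ h₂ => rw [map_add, map_add, h₁, h₂, add_zero]
  | smul c x _ h => rw [map_smul, map_smul, h, smul_zero]

/-- The form pairs morphisms x : a → b with morphisms τ b → a of complementary degree. Nondegeneracy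
gives the prolongations; a maximal bound path then admits only the trivial one, hence has length n +
1 and starts at the translate of its end. -/
theorem isStableTranslation (n : ℕ) (τ : Equiv.Perm W) (form : E →ₗ[k] k)
    (left : ∀ {a b : W} {t : ℕ} {x : E}, x ∈ C.hom a b t → x ≠ 0 →
      ∃ t', t + t' = n + 1 ∧ ∃ y ∈ C.hom (τ b) a t', form (x * y) ≠ 0)
    (right : ∀ {a b : W} {t : ℕ} {x : E}, x ∈ C.hom (τ a) b t → x ≠ 0 →
      ∃ t', t + t' = n + 1 ∧ ∃ y ∈ C.hom b a t', form (y * x) ≠ 0)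
    (top : ∀ {a : W} {x : E}, x ∈ C.hom (τ a) a (n + 1) → form x = 0 → x = 0) :
    C.boundQuiver.IsStableTranslation n τ := by
  have prolong_left : ∀ (i j : W) (t : ℕ) (x : Path j i →₀ k),
      (∀ p ∈ x.support, p.length = t) → x ∉ C.boundQuiver.relIdeal j i →
      ∃ q : Path (τ i) j, q.length + t = n + 1 ∧
        BoundQuiver.pathComp k (τ i) j i (Finsupp.single q 1) x ∉
          C.boundQuiver.relIdeal (τ i) i := by
    intro i j t x hx hx0
    rw [mem_relIdeal_iff] at hx0
    obtain ⟨t', ht', y, hy, hxy⟩ := left (C.eval_mem hx) hx0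
    obtain ⟨q, hq, hqx⟩ := C.exists_path_mul_ne_zero
      (form ∘ₗ LinearMap.mulLeft k (C.eval j i x)) hy hxy
    refine ⟨q, by omega, fun h => hqx ?_⟩
    rw [mem_relIdeal_iff, eval_pathComp, eval_single, one_smul] at h
    rw [LinearMap.comp_apply, LinearMap.mulLeft_apply, h, map_zero]
  refine ⟨fun i j p hp => ?_, fun i j p hp => ?_, fun i p q hp hq hpb hqb => ?_,
    fun i j t x _ => prolong_left i j t x, fun i j t x _ hx hx0 => ?_⟩
  · obtain ⟨t', ht', _⟩ := left (C.val_mem p) ((C.isBoundPath_iff p).1 hp)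
    omega
  · obtain ⟨q, hq, hqp⟩ := prolong_left j i p.length (Finsupp.single p 1)
      (BoundQuiver.single_mem_homogeneous p 1) hp.1
    cases q with
    | nil => exact ⟨by simpa using hq, rfl⟩
    | cons q' α =>
      refine (hp.2.2 _ α fun hmem => hqp ?_).elim
      rw [BoundQuiver.pathComp_single, one_mul, ← Path.comp_toPath_eq_cons, Path.comp_assoc,
        ← one_mul (1 : k), ← BoundQuiver.pathComp_single]
      exact C.boundQuiver.pathComp_mem_right _ _ _ _ hmem
  · rw [isBoundPath_iff] at hqb
    have hform : form (C.val q) ≠ 0 := fun h => hqb (top (hq ▸ C.val_mem q) h)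
    -- The form is injective on the top degree from τ i to i, so the ratio of its values is the
    -- coefficient.
    refine ⟨form (C.val p) / form (C.val q), ?_⟩
    rw [BoundQuiver.pathClass, BoundQuiver.pathClass, ← Submodule.Quotient.mk_smul,
      Submodule.Quotient.eq, mem_relIdeal_iff, map_sub, map_smul, eval_single, eval_single,
      one_smul, one_smul]
    refine top (sub_mem (hp ▸ C.val_mem p) (Submodule.smul_mem _ _ (hq ▸ C.val_mem q))) ?_
    rw [map_sub, map_smul, smul_eq_mul, div_mul_cancel₀ _ hform, sub_self]
  · rw [mem_relIdeal_iff] at hx0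
    obtain ⟨t', ht', y, hy, hxy⟩ := right (C.eval_mem hx) hx0
    obtain ⟨q, hq, hqx⟩ := C.exists_path_mul_ne_zero
      (form ∘ₗ LinearMap.mulRight k (C.eval (τ i) j x)) hy hxy
    refine ⟨q, by omega, fun h => hqx ?_⟩
    rw [mem_relIdeal_iff, eval_pathComp, eval_single, one_smul] at h
    rw [LinearMap.comp_apply, LinearMap.mulRight_apply, h, map_zero]

end GradedHoms

/-! ### Coverings of bigraded Frobenius algebras -/

/-- A bigraded algebra inside `E`, generated in the degrees `(d, 1)`, whose part of degree zero is
spanned by orthogonal idempotents, with a symmetric nondegenerate form of degree `(1, n + 1)`. -/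
structure BigradedFrobenius (k : Type w) [Field k] (ι : Type u') [Fintype ι] (E : Type*) [Ring E]
    [Algebra k E] (n : ℕ) where
  idem : ι → E
  part : ℤ → ℕ → Submodule k E
  form : E →ₗ[k] k
  rel : ι → ι → Prop
  idem_ne_zero : ∀ i, idem i ≠ 0
  idem_mul_self : ∀ i, idem i * idem i = idem i
  idem_mul_of_ne : ∀ i j, i ≠ j → idem i * idem j = 0
  sum_idem : ∑ i, idem i = 1
  part_zero : part 0 0 = Submodule.span k (Set.range idem)
  part_zero_of_ne : ∀ d, d ≠ 0 → part d 0 = ⊥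
  mul_mem : ∀ {d d' s t x y}, x ∈ part d s → y ∈ part d' t → x * y ∈ part (d + d') (s + t)
  part_succ_le : ∀ d t, part d (t + 1) ≤ ⨆ d', part d' 1 * part (d - d') t
  finite : ∀ d, FiniteDimensional k (part d 1)
  independent : ∀ (d) (s : Finset ℕ) (x : ℕ → E), (∀ t, x t ∈ part d t) →
    ∑ t ∈ s, x t = 0 → ∀ t ∈ s, x t = 0
  form_comm : ∀ {d d' s t x y}, x ∈ part d s → y ∈ part d' t → form (x * y) = form (y * x)
  exists_form_ne_zero : ∀ {d t x}, x ∈ part d t → x ≠ 0 →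
    ∃ t', t + t' = n + 1 ∧ ∃ y ∈ part (1 - d) t', form (x * y) ≠ 0
  part_of_neg : ∀ d, d < 0 → part d 1 = ⊥
  rel_trans : ∀ {i j l}, rel i j → rel j l → rel i l
  rel_irrefl : ∀ i, ¬ rel i i
  rel_of_ne_zero : ∀ {i j x}, x ∈ part 0 1 → idem j * x = x → x * idem i = x → x ≠ 0 → rel i j

/-- The vertices of the covering. -/
structure CoverVertex (ι : Type u') : Type u' where
  vertex : ι
  level : ℤ

namespace CoverVertex

variable {ι : Type u'}

/-- The translation of the covering. -/
def translation : Equiv.Perm (CoverVertex ι) where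
  toFun a := ⟨a.vertex, a.level - 1⟩
  invFun a := ⟨a.vertex, a.level + 1⟩
  left_inv a := by simp
  right_inv a := by simp

theorem translation_zpow (m : ℤ) (a : CoverVertex ι) :
    (translation ^ m) a = ⟨a.vertex, a.level - m⟩ := by
  have hnat : ∀ (r : ℕ) (a : CoverVertex ι),
      (translation ^ r) a = ⟨a.vertex, a.level - r⟩ := by
    intro r
    induction r with
    | zero => intro a; simp
    | succ r ih =>
      intro a
      rw [pow_succ', Equiv.Perm.mul_apply, ih]
      change CoverVertex.mk _ _ = _
      congr 1
      push_cast
      ring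
  obtain ⟨r, rfl | rfl⟩ := m.eq_nat_or_neg
  · rw [zpow_natCast, hnat]
  · rw [zpow_neg, zpow_natCast, Equiv.Perm.inv_eq_iff_eq, hnat]
    simp

theorem sameCycle_iff (a b : CoverVertex ι) :
    translation.SameCycle a b ↔ a.vertex = b.vertex := by
  constructor
  · rintro ⟨m, h⟩
    rw [translation_zpow] at h
    rw [← h]
  · intro h
    refine ⟨a.level - b.level, ?_⟩
    rw [translation_zpow, h]
    simp

theorem finite_orbits [Finite ι] :
    Finite (Quotient (Equiv.Perm.SameCycle.setoid (translation (ι := ι)))) := by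
  refine Finite.of_surjective (fun i : ι => Quotient.mk _ (⟨i, 0⟩ : CoverVertex ι)) ?_
  intro x
  induction x using Quotient.inductionOn with
  | h a => exact ⟨a.vertex, Quotient.sound ((sameCycle_iff _ _).2 rfl)⟩

/-- The vertices of level zero. -/
def zeroLevel (ι : Type u') : Set (CoverVertex ι) := {a | a.level = 0}

end CoverVertex

namespace BigradedFrobenius

variable {k : Type w} [Field k] {ι : Type u'} [Fintype ι] {E : Type*} [Ring E] [Algebra k E]
  {n : ℕ} (F : BigradedFrobenius k ι E n)

theorem idem_mem (i : ι) : F.idem i ∈ F.part 0 0 := by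
  rw [F.part_zero]
  exact Submodule.subset_span ⟨i, rfl⟩

theorem idem_mul_mem {d : ℤ} {t : ℕ} {x : E} (hx : x ∈ F.part d t) (i : ι) :
    F.idem i * x ∈ F.part d t := by
  simpa using F.mul_mem (F.idem_mem i) hx

theorem mul_idem_mem {d : ℤ} {t : ℕ} {x : E} (hx : x ∈ F.part d t) (i : ι) :
    x * F.idem i ∈ F.part d t := by
  simpa using F.mul_mem hx (F.idem_mem i)

/-- The morphisms of the covering. -/
def coverHom (a b : CoverVertex ι) (t : ℕ) : Submodule k E where
  carrier := {x | x ∈ F.part (b.level - a.level) t ∧ F.idem b.vertex * x = x ∧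
    x * F.idem a.vertex = x}
  zero_mem' := ⟨zero_mem _, mul_zero _, zero_mul _⟩
  add_mem' := by
    rintro x y ⟨hx, hx₁, hx₂⟩ ⟨hy, hy₁, hy₂⟩
    exact ⟨add_mem hx hy, by rw [mul_add, hx₁, hy₁], by rw [add_mul, hx₂, hy₂]⟩
  smul_mem' := by
    rintro c x ⟨hx, hx₁, hx₂⟩
    exact ⟨Submodule.smul_mem _ c hx, by rw [mul_smul_comm, hx₁], by rw [smul_mul_assoc, hx₂]⟩

theorem idem_mul_mul_idem_mem {a b : CoverVertex ι} {t : ℕ} {x : E}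
    (hx : x ∈ F.part (b.level - a.level) t) :
    F.idem b.vertex * x * F.idem a.vertex ∈ F.coverHom a b t := by
  refine ⟨F.mul_idem_mem (F.idem_mul_mem hx _) _, ?_, ?_⟩
  · rw [← mul_assoc, ← mul_assoc, F.idem_mul_self]
  · rw [mul_assoc, F.idem_mul_self]

theorem idem_mul_of_mem_part_zero {x : E} (hx : x ∈ F.part 0 0) (i : ι) :
    ∃ c : k, F.idem i * x = c • F.idem i := by
  rw [F.part_zero] at hx
  induction hx using Submodule.span_induction with
  | mem x h =>
    obtain ⟨j, rfl⟩ := h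
    by_cases hij : i = j
    · subst hij
      exact ⟨1, by rw [F.idem_mul_self, one_smul]⟩
    · exact ⟨0, by rw [F.idem_mul_of_ne i j hij, zero_smul]⟩
  | zero => exact ⟨0, by simp⟩
  | add x y _ _ h₁ h₂ =>
    obtain ⟨c, h₁⟩ := h₁
    obtain ⟨d, h₂⟩ := h₂
    exact ⟨c + d, by rw [mul_add, h₁, h₂, add_smul]⟩
  | smul c x _ h =>
    obtain ⟨d, h⟩ := h
    exact ⟨c * d, by rw [mul_smul_comm, h, mul_smul]⟩

theorem finiteDimensional_coverHom (a b : CoverVertex ι) :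
    FiniteDimensional k (F.coverHom a b 1) := by
  have := F.finite (b.level - a.level)
  exact Submodule.finiteDimensional_of_le
    (show F.coverHom a b 1 ≤ F.part (b.level - a.level) 1 from fun _ hx => hx.1)

/-- The quiver of the covering. -/
@[reducible]
def coverQuiver : Quiver.{v'} (CoverVertex ι) :=
  ⟨fun a b => ULift.{v'} (Fin (Module.finrank k (F.coverHom a b 1)))⟩

theorem coverHom_succ_le (a b : CoverVertex ι) (t : ℕ) :
    F.coverHom a b (t + 1) ≤ ⨆ c, F.coverHom c b 1 * F.coverHom a c t := by
  intro x hx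
  have key : ∀ y ∈ ⨆ d', F.part d' 1 * F.part (b.level - a.level - d') t,
      F.idem b.vertex * y * F.idem a.vertex ∈ ⨆ c, F.coverHom c b 1 * F.coverHom a c t := by
    intro y hy
    induction hy using Submodule.iSup_induction' with
    | mem d y hy =>
      induction hy using Submodule.mul_induction_on' with
      | mem_mul_mem u hu v hv =>
        have h : F.idem b.vertex * (u * v) * F.idem a.vertex = ∑ l, (F.idem b.vertex * u *
            F.idem l) * (F.idem l * v * F.idem a.vertex) := by
          have h' : ∀ l, (F.idem b.vertex * u * F.idem l) * (F.idem l * v * F.idem a.vertex) =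
              F.idem b.vertex * u * F.idem l * (v * F.idem a.vertex) := fun l => by
            rw [mul_assoc (F.idem l) v, ← mul_assoc _ (F.idem l), mul_assoc _ (F.idem l) (F.idem l),
              F.idem_mul_self]
          simp only [h']
          rw [← Finset.sum_mul, ← Finset.mul_sum, F.sum_idem, mul_one]
          simp only [mul_assoc]
        rw [h]
        refine Submodule.sum_mem _ fun l _ => ?_
        -- After inserting 1 = ∑ e_l between the factors, a left factor of first degree d ending at
        -- the level of b must start d levels lower.
        let c : CoverVertex ι := ⟨l, b.level - d⟩
        refine Submodule.mem_iSup_of_mem c (Submodule.mul_mem_mul ?_ ?_)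
        · exact F.idem_mul_mul_idem_mem (a := c) (b := b)
            (by rwa [show b.level - c.level = d from sub_sub_cancel _ _])
        · exact F.idem_mul_mul_idem_mem (a := a) (b := c)
            (by rwa [show c.level - a.level = b.level - a.level - d from sub_right_comm _ _ _])
      | add u _ v _ h₁ h₂ =>
        rw [mul_add, add_mul]
        exact add_mem h₁ h₂
    | zero => rw [mul_zero, zero_mul]; exact zero_mem _
    | add u v _ _ h₁ h₂ =>
      rw [mul_add, add_mul]
      exact add_mem h₁ h₂
  have := key x (F.part_succ_le _ _ hx.1)
  rwa [hx.2.1, hx.2.2] at this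

/-- The graded category which covers a bigraded algebra. -/
def cover : letI := F.coverQuiver.{w, u', v'}; GradedHoms k (CoverVertex ι) E :=
  letI := F.coverQuiver.{w, u', v'}
  { idem := fun a => F.idem a.vertex
    hom := F.coverHom
    finite := fun a b =>
      (inferInstance : Finite (ULift.{v'} (Fin (Module.finrank k (F.coverHom a b 1)))))
    basis := fun a b =>
      haveI := F.finiteDimensional_coverHom a b
      (Module.finBasis k (F.coverHom a b 1)).reindex Equiv.ulift.symm
    idem_ne_zero := fun a => F.idem_ne_zero _
    hom_zero := fun a => by
      apply le_antisymm
      · rintro x ⟨hx, hx₁, hx₂⟩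
        rw [sub_self] at hx
        obtain ⟨c, hc⟩ := F.idem_mul_of_mem_part_zero hx a.vertex
        rw [← hx₁, hc]
        exact Submodule.smul_mem _ c (Submodule.subset_span rfl)
      · rw [Submodule.span_singleton_le_iff_mem]
        refine ⟨?_, F.idem_mul_self _, F.idem_mul_self _⟩
        rw [sub_self]
        exact F.idem_mem _
    hom_zero_of_ne := fun a b hab => by
      rw [eq_bot_iff]
      rintro x ⟨hx, hx₁, hx₂⟩
      rw [Submodule.mem_bot]
      by_cases hl : b.level - a.level = 0
      · rw [hl] at hx
        obtain ⟨c, hc⟩ := F.idem_mul_of_mem_part_zero hx b.vertex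
        rw [← hx₂, ← hx₁, hc, smul_mul_assoc, F.idem_mul_of_ne, smul_zero]
        intro hv
        apply hab
        cases a
        cases b
        simp only [CoverVertex.mk.injEq] at hv hl ⊢
        exact ⟨hv.symm, by omega⟩
      · rw [F.part_zero_of_ne _ hl] at hx
        exact hx
    idem_mul := fun hx => hx.2.1
    mul_idem := fun hx => hx.2.2
    mul_mem := fun {a b c t x y} hx hy => by
      refine ⟨?_, by rw [← mul_assoc, hx.2.1], by rw [mul_assoc, hy.2.2]⟩
      have := F.mul_mem hx.1 hy.1
      rwa [add_comm 1 t, sub_add_sub_cancel] at this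
    hom_succ_le := F.coverHom_succ_le
    independent := fun a b s x hx => F.independent _ s x fun t => (hx t).1 }

/-- The form has first degree one, so it pairs level difference d with 1 - d; the surplus of one
level is exactly the shift made by the translation. Symmetry moves idempotents around the product
and gives both sides of the duality. -/
theorem isStableTranslation_cover :
    letI := F.coverQuiver.{w, u', v'}
    F.cover.boundQuiver.IsStableTranslation n CoverVertex.translation := by
  let := F.coverQuiver.{w, u', v'}
  refine F.cover.isStableTranslation n _ F.form ?_ ?_ ?_
  · rintro a b t x ⟨hx, hx₁, hx₂⟩ hx0
    obtain ⟨t', ht', y, hy, hxy⟩ := F.exists_form_ne_zero hx hx0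
    refine ⟨t', ht', F.idem a.vertex * y * F.idem b.vertex, ?_, ?_⟩
    · refine F.idem_mul_mul_idem_mem (a := CoverVertex.translation b) (b := a) ?_
      rwa [show a.level - (CoverVertex.translation b).level = 1 - (b.level - a.level) from by
        change a.level - (b.level - 1) = _; ring]
    · rw [← mul_assoc, ← mul_assoc, hx₂, F.form_comm (F.mul_mem hx hy) (F.idem_mem _), ← mul_assoc,
        hx₁]
      exact hxy
  · rintro a b t x ⟨hx, hx₁, hx₂⟩ hx0
    obtain ⟨t', ht', y, hy, hxy⟩ := F.exists_form_ne_zero hx hx0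
    refine ⟨t', ht', F.idem a.vertex * y * F.idem b.vertex, ?_, ?_⟩
    · refine F.idem_mul_mul_idem_mem (a := b) (b := a) ?_
      rwa [show a.level - b.level = 1 - (b.level - (CoverVertex.translation a).level) from by
        change _ = 1 - (b.level - (a.level - 1)); ring]
    · have hx₂' : x * F.idem a.vertex = x := hx₂
      rw [mul_assoc, hx₁, mul_assoc, F.form_comm (F.idem_mem _) (F.mul_mem hy hx), mul_assoc, hx₂',
        F.form_comm hy hx]
      exact hxy
  · rintro a x ⟨hx, hx₁, hx₂⟩ hform
    by_contra hx0
    obtain ⟨t', ht', y, hy, hxy⟩ := F.exists_form_ne_zero hx hx0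
    -- The partner of a morphism of top degree has bidegree (0, 0), so it acts on the idempotent as
    -- a scalar, and the form cannot vanish on the morphism itself.
    obtain rfl : t' = 0 := by omega
    rw [show 1 - (a.level - (CoverVertex.translation a).level) = 0 from by
      change 1 - (a.level - (a.level - 1)) = _; ring] at hy
    obtain ⟨c, hc⟩ := F.idem_mul_of_mem_part_zero hy a.vertex
    have hx₂' : x * F.idem a.vertex = x := hx₂
    rw [← hx₂', mul_assoc, hc, mul_smul_comm, hx₂', map_smul, hform, smul_zero] at hxy
    exact hxy rfl

/-- Arrows cannot lower the level, because degree one has no part of negative first degree; arrows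
that keep the level follow `rel`. Both acyclicity and convexity of level zero rest on this. -/
theorem level_or_rel {a b : CoverVertex ι} :
    letI := F.coverQuiver.{w, u', v'}
    ∀ p : Path a b, p.length = 0 ∨ a.level < b.level ∨
      a.level = b.level ∧ F.rel a.vertex b.vertex := by
  let := F.coverQuiver.{w, u', v'}
  intro p
  induction p with
  | nil => exact Or.inl rfl
  | @cons b c p α ih =>
    right
    have hne : ∃ x ∈ F.coverHom b c 1, x ≠ 0 := by
      by_contra! hcon
      have hbot : F.coverHom b c 1 = ⊥ := (Submodule.eq_bot_iff _).2 hcon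
      have hα : Fin (Module.finrank k (F.coverHom b c 1)) := α.down
      rw [hbot, finrank_bot] at hα
      exact hα.elim0
    obtain ⟨x, ⟨hx, hx₁, hx₂⟩, hx0⟩ := hne
    have hlevel : b.level ≤ c.level := by
      by_contra hlt
      rw [F.part_of_neg _ (by omega)] at hx
      exact hx0 hx
    have hrel : b.level = c.level → F.rel b.vertex c.vertex := by
      intro h
      rw [h, sub_self] at hx
      exact F.rel_of_ne_zero hx hx₁ hx₂ hx0
    have hab : a = b ∨ a.level < b.level ∨ a.level = b.level ∧ F.rel a.vertex b.vertex := by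
      rcases ih with h | h
      · exact Or.inl (Path.eq_of_length_zero p h)
      · exact Or.inr h
    rcases hlevel.lt_or_eq with hlt | heq
    · left
      rcases hab with rfl | h | h <;> omega
    · rcases hab with rfl | h | h
      · exact Or.inr ⟨heq, hrel heq⟩
      · exact Or.inl (by omega)
      · exact Or.inr ⟨h.1.trans heq, F.rel_trans h.2 (hrel heq)⟩

theorem quiverAcyclic_cover :
    letI := F.coverQuiver.{w, u', v'}
    QuiverAcyclic (CoverVertex ι) := by
  let := F.coverQuiver.{w, u', v'}
  intro a p
  rcases F.level_or_rel p with h | h | h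
  · exact h
  · exact (lt_irrefl _ h).elim
  · exact (F.rel_irrefl _ h.2).elim

theorem isCompleteSlice_zeroLevel :
    letI := F.coverQuiver.{w, u', v'}
    IsCompleteSlice CoverVertex.translation (CoverVertex.zeroLevel ι) := by
  let := F.coverQuiver.{w, u', v'}
  have hlevel : ∀ {a b : CoverVertex ι}, Path a b → a.level ≤ b.level := by
    intro a b p
    rcases F.level_or_rel p with h | h | h
    · rw [Path.eq_of_length_zero p h]
    · exact h.le
    · exact h.1.le
  refine ⟨fun a => ?_, fun i j l p q hi hl => ?_⟩
  · refine ⟨⟨a.vertex, 0⟩, ⟨rfl, (CoverVertex.sameCycle_iff _ _).2 rfl⟩, ?_⟩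
    rintro ⟨i, m⟩ ⟨hm, h⟩
    rw [CoverVertex.sameCycle_iff] at h
    have hm' : m = 0 := hm
    rw [hm', h]
  · have h₁ := hlevel p
    have h₂ := hlevel q
    have hi' : i.level = 0 := hi
    have hl' : l.level = 0 := hl
    change j.level = 0
    omega

end BigradedFrobenius

/-! ### The trivial extension by the dual bimodule -/

section TrivialExtension

variable (k : Type*) [Field k] (A : Type*) [Ring A] [Algebra k A]

/-- Left multiplication by an element of the algebra on the trivial extension. -/
def extLeft : A →ₗ[k] Module.End k (A × Module.Dual k A) where
  toFun x := (LinearMap.mulLeft k x).prodMap (LinearMap.lcomp k k (LinearMap.mulRight k x))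
  map_add' x y := by
    refine LinearMap.ext fun z => Prod.ext ?_ (LinearMap.ext fun a => ?_)
    · simp [add_mul]
    · simp [mul_add]
  map_smul' c x := by
    refine LinearMap.ext fun z => Prod.ext ?_ (LinearMap.ext fun a => ?_)
    · simp
    · simp

/-- Left multiplication by a functional on the trivial extension. -/
def extDual : Module.Dual k A →ₗ[k] Module.End k (A × Module.Dual k A) where
  toFun f := LinearMap.inr k A (Module.Dual k A) ∘ₗ (LinearMap.mul k A).compr₂ f ∘ₗ
    LinearMap.fst k A (Module.Dual k A)
  map_add' f g := by
    refine LinearMap.ext fun z => Prod.ext ?_ (LinearMap.ext fun a => ?_) <;> simp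
  map_smul' c f := by
    refine LinearMap.ext fun z => Prod.ext ?_ (LinearMap.ext fun a => ?_) <;> simp

/-- The symmetrising form of the trivial extension. -/
def extForm : Module.End k (A × Module.Dual k A) →ₗ[k] k where
  toFun T := (T (1, 0)).2 1
  map_add' S T := by simp
  map_smul' c T := by simp

variable {k A}

theorem extLeft_apply (x : A) (z : A × Module.Dual k A) :
    extLeft k A x z = (x * z.1, z.2 ∘ₗ LinearMap.mulRight k x) := rfl

theorem extDual_apply (f : Module.Dual k A) (z : A × Module.Dual k A) :
    extDual k A f z = (0, f ∘ₗ LinearMap.mulLeft k z.1) := rfl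

theorem extLeft_one : extLeft k A 1 = 1 := by
  refine LinearMap.ext fun z => Prod.ext ?_ (LinearMap.ext fun a => ?_) <;>
    simp [extLeft_apply]

theorem extLeft_mul (x y : A) : extLeft k A x * extLeft k A y = extLeft k A (x * y) := by
  refine LinearMap.ext fun z => Prod.ext ?_ (LinearMap.ext fun a => ?_) <;>
    simp [extLeft_apply, mul_assoc]

theorem extLeft_mul_extDual (x : A) (f : Module.Dual k A) :
    extLeft k A x * extDual k A f = extDual k A (f ∘ₗ LinearMap.mulRight k x) := by
  refine LinearMap.ext fun z => Prod.ext ?_ (LinearMap.ext fun a => ?_) <;>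
    simp [extLeft_apply, extDual_apply, mul_assoc]

theorem extDual_mul_extLeft (x : A) (f : Module.Dual k A) :
    extDual k A f * extLeft k A x = extDual k A (f ∘ₗ LinearMap.mulLeft k x) := by
  refine LinearMap.ext fun z => Prod.ext ?_ (LinearMap.ext fun a => ?_) <;>
    simp [extLeft_apply, extDual_apply]

theorem extDual_mul_extDual (f g : Module.Dual k A) : extDual k A f * extDual k A g = 0 := by
  refine LinearMap.ext fun z => Prod.ext ?_ (LinearMap.ext fun a => ?_) <;>
    simp [extDual_apply]

theorem extLeft_injective : Function.Injective (extLeft k A) := fun x y h => by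
  simpa [extLeft_apply] using congrArg (fun T => (T (1, 0)).1) h

theorem extDual_injective : Function.Injective (extDual k A) := fun f g h => by
  refine LinearMap.ext fun a => ?_
  simpa [extDual_apply] using congrArg (fun T => (T (1, 0)).2 a) h

theorem extForm_extLeft (x : A) : extForm k A (extLeft k A x) = 0 := by
  simp [extForm, extLeft_apply]

theorem extForm_extDual (f : Module.Dual k A) : extForm k A (extDual k A f) = f 1 := by
  simp [extForm, extDual_apply]

end TrivialExtension

/-! ### The bigraded Frobenius structure on the trivial extension of Λ -/

namespace BoundQuiver

variable {k : Type w} [Field k] {V : Type u} [Quiver.{v} V] [Finite V] (Q : BoundQuiver k V)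

omit [Finite V] in
theorem ofPath_mem_of_length {i j : V} {t : ℕ} (p : Path i j) (hp : p.length = t) :
    Q.ofPath p ∈ Q.degreePart t :=
  Submodule.subset_span ⟨i, j, p, hp, rfl⟩

/-- The functionals which vanish on the parts of degree different from `n + 1 - t`. -/
def dualPart (n t : ℕ) : Submodule k (Module.Dual k Q.PathAlg) where
  carrier := {f | ∀ s, s + t ≠ n + 1 → ∀ x ∈ Q.degreePart s, f x = 0}
  zero_mem' _ _ _ _ := rfl
  add_mem' {f g} hf hg s hs x hx := by rw [LinearMap.add_apply, hf s hs x hx, hg s hs x hx, add_zero]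
  smul_mem' c f hf s hs x hx := by rw [LinearMap.smul_apply, hf s hs x hx, smul_zero]

variable {Q} {n : ℕ}

theorem comp_part_mem_dualPart {s t : ℕ} (h : s + t = n + 1) (f : Module.Dual k Q.PathAlg) :
    f ∘ₗ Q.part s ∈ Q.dualPart n t := by
  intro r hr x hx
  rw [LinearMap.comp_apply, Q.part_of_mem_ne hx (by rintro rfl; exact hr h), map_zero]

theorem eq_part_of_mem_dualPart {s t : ℕ} (h : s + t = n + 1) {f : Module.Dual k Q.PathAlg}
    (hf : f ∈ Q.dualPart n t) (x : Q.PathAlg) : f x = f (Q.part s x) := by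
  rw [← sub_eq_zero, ← map_sub]
  have : x - Q.part s x ∈ LinearMap.ker f := by
    refine Q.mem_of_part_mem _ fun r => ?_
    rw [map_sub, LinearMap.mem_ker]
    by_cases hr : r = s
    · subst hr
      rw [Q.part_of_mem (Q.part_mem r x), sub_self, map_zero]
    · rw [Q.part_of_mem_ne (Q.part_mem s x) (Ne.symm hr), sub_zero]
      exact hf r (by omega) _ (Q.part_mem r x)
  exact this

theorem eq_zero_of_mem_dualPart {t : ℕ} (ht : n + 1 < t) {f : Module.Dual k Q.PathAlg}
    (hf : f ∈ Q.dualPart n t) : f = 0 := by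
  refine LinearMap.ext fun x => ?_
  have : x ∈ LinearMap.ker f :=
    Q.mem_of_part_mem _ fun r => hf r (by omega) _ (Q.part_mem r x)
  exact this

theorem Prolongs.le_of_ne_zero (h : Q.Prolongs n) {t : ℕ} {x : Q.PathAlg}
    (hx : x ∈ Q.degreePart t) (hx0 : x ≠ 0) : t ≤ n := by
  obtain ⟨_, _, p, _, _, q, hn, _⟩ := h t x hx hx0
  omega

theorem comp_mulRight_mem_dualPart {s t : ℕ} {x : Q.PathAlg} (hx : x ∈ Q.degreePart s)
    {f : Module.Dual k Q.PathAlg} (hf : f ∈ Q.dualPart n t) :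
    f ∘ₗ LinearMap.mulRight k x ∈ Q.dualPart n (s + t) := fun r hr _ hy =>
  hf (r + s) (by omega) _ (Q.mul_mem_degreePart hy hx)

theorem comp_mulLeft_mem_dualPart {s t : ℕ} {x : Q.PathAlg} (hx : x ∈ Q.degreePart s)
    {f : Module.Dual k Q.PathAlg} (hf : f ∈ Q.dualPart n t) :
    f ∘ₗ LinearMap.mulLeft k x ∈ Q.dualPart n (t + s) := fun r hr _ hy =>
  hf (s + r) (by omega) _ (Q.mul_mem_degreePart hx hy)

/-- This is where prolongation yields generation in degree one. By duality it suffices that an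
element x killed by the right-hand side is killed by f. Only the component of degree n - t matters;
if it were nonzero, a prolongation of it to degree n would contradict the vanishing of one of the
two kinds of generators at x. -/
theorem Prolongs.dualPart_succ_le [FiniteDimensional k Q.PathAlg] (h : Q.Prolongs n) (t : ℕ) :
    Q.dualPart n (t + 1) ≤ Submodule.span k
      ({f | ∃ x ∈ Q.degreePart 1, ∃ g ∈ Q.dualPart n t, f = g ∘ₗ LinearMap.mulRight k x} ∪
        {f | ∃ g ∈ Q.dualPart n 1, ∃ x ∈ Q.degreePart t, f = g ∘ₗ LinearMap.mulLeft k x}) := by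
  intro f hf
  by_contra hcon
  obtain ⟨G, hG, hker⟩ := Submodule.exists_le_ker_of_notMem hcon
  obtain ⟨x, rfl⟩ := (Module.evalEquiv k Q.PathAlg).surjective G
  have hfx : f x ≠ 0 := hG
  have hker' : ∀ g ∈ ({f | ∃ x ∈ Q.degreePart 1, ∃ g ∈ Q.dualPart n t,
        f = g ∘ₗ LinearMap.mulRight k x} ∪
        {f | ∃ g ∈ Q.dualPart n 1, ∃ x ∈ Q.degreePart t, f = g ∘ₗ LinearMap.mulLeft k x} :
        Set (Module.Dual k Q.PathAlg)), g x = 0 := fun g hg => hker (Submodule.subset_span hg)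
  have htn : t ≤ n := by
    by_contra hlt
    rw [eq_zero_of_mem_dualPart (by omega) hf] at hfx
    exact hfx rfl
  have hx0 : Q.part (n - t) x ≠ 0 := by
    intro h0
    rw [eq_part_of_mem_dualPart (s := n - t) (by omega) hf, h0, map_zero] at hfx
    exact hfx rfl
  obtain ⟨i, j, p, i', j', q, hn, hpq⟩ := h _ _ (Q.part_mem (n - t) x) hx0
  -- If q is nontrivial, its last arrow already multiplies the component to something nonzero,
  -- against the first kind of generators. Otherwise p carries the whole length t and leads to
  -- degree n, against the second kind.
  cases q with
  | @cons l _ q α =>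
    rw [← Path.comp_toPath_eq_cons, ← ofPath_mul_ofPath, ← mul_assoc, mul_assoc (Q.ofPath p)] at hpq
    have hα : Q.part (n - t) x * Q.ofPath α.toPath ≠ 0 := by
      intro h0
      rw [h0, mul_zero, zero_mul] at hpq
      exact hpq rfl
    apply hα
    rw [← Module.forall_dual_apply_eq_zero_iff k]
    intro g
    have hmem : Q.ofPath α.toPath ∈ Q.degreePart 1 :=
      Q.ofPath_mem_of_length _ (Path.length_toPath α)
    rw [← Q.part_mul_right hmem]
    exact hker' _ (Or.inl ⟨_, hmem, g ∘ₗ Q.part (n - t + 1),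
      comp_part_mem_dualPart (by omega) g, rfl⟩)
  | nil =>
    have hp : Q.ofPath p * Q.part (n - t) x ≠ 0 := by
      intro h0
      rw [h0, zero_mul] at hpq
      exact hpq rfl
    have hlen : p.length = t := by
      simp only [Path.length_nil] at hn
      omega
    apply hp
    rw [← Module.forall_dual_apply_eq_zero_iff k]
    intro g
    have hmem : Q.ofPath p ∈ Q.degreePart t := Q.ofPath_mem_of_length p hlen
    rw [← Q.part_mul_left hmem]
    exact hker' _ (Or.inr ⟨g ∘ₗ Q.part (t + (n - t)), comp_part_mem_dualPart (by omega) g, _, hmem,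
      rfl⟩)

variable (Q n)

/-- The bigrading of the trivial extension. -/
def extPart (d : ℤ) (t : ℕ) :
    Submodule k (Module.End k (Q.PathAlg × Module.Dual k Q.PathAlg)) :=
  if d = 0 then (Q.degreePart t).map (extLeft k Q.PathAlg)
  else if d = 1 then (Q.dualPart n t).map (extDual k Q.PathAlg) else ⊥

theorem extPart_zero (t : ℕ) : Q.extPart n 0 t = (Q.degreePart t).map (extLeft k Q.PathAlg) :=
  if_pos rfl

theorem extPart_one (t : ℕ) : Q.extPart n 1 t = (Q.dualPart n t).map (extDual k Q.PathAlg) := by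
  rw [extPart, if_neg one_ne_zero, if_pos rfl]

theorem extPart_of_ne {d : ℤ} (h₀ : d ≠ 0) (h₁ : d ≠ 1) (t : ℕ) : Q.extPart n d t = ⊥ := by
  rw [extPart, if_neg h₀, if_neg h₁]

variable {Q n}

theorem extPart_cases {d : ℤ} {t : ℕ} {x : Module.End k (Q.PathAlg × Module.Dual k Q.PathAlg)}
    (hx : x ∈ Q.extPart n d t) :
    (d = 0 ∧ ∃ y ∈ Q.degreePart t, x = extLeft k Q.PathAlg y) ∨
      (d = 1 ∧ ∃ f ∈ Q.dualPart n t, x = extDual k Q.PathAlg f) ∨ x = 0 := by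
  by_cases h₀ : d = 0
  · subst h₀
    rw [extPart_zero] at hx
    obtain ⟨y, hy, rfl⟩ := hx
    exact Or.inl ⟨rfl, y, hy, rfl⟩
  by_cases h₁ : d = 1
  · subst h₁
    rw [extPart_one] at hx
    obtain ⟨y, hy, rfl⟩ := hx
    exact Or.inr (Or.inl ⟨rfl, y, hy, rfl⟩)
  rw [extPart_of_ne Q n h₀ h₁] at hx
  exact Or.inr (Or.inr hx)

theorem extLeft_mem_extPart {t : ℕ} {x : Q.PathAlg} (hx : x ∈ Q.degreePart t) :
    extLeft k Q.PathAlg x ∈ Q.extPart n 0 t := by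
  rw [extPart_zero]
  exact Submodule.mem_map_of_mem hx

theorem extDual_mem_extPart {t : ℕ} {f : Module.Dual k Q.PathAlg} (hf : f ∈ Q.dualPart n t) :
    extDual k Q.PathAlg f ∈ Q.extPart n 1 t := by
  rw [extPart_one]
  exact Submodule.mem_map_of_mem hf

theorem extPart_mul_mem {d d' : ℤ} {s t : ℕ}
    {x y : Module.End k (Q.PathAlg × Module.Dual k Q.PathAlg)} (hx : x ∈ Q.extPart n d s)
    (hy : y ∈ Q.extPart n d' t) : x * y ∈ Q.extPart n (d + d') (s + t) := by
  obtain ⟨rfl, x, hx', rfl⟩ | ⟨rfl, f, hf, rfl⟩ | rfl := extPart_cases hx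
  · obtain ⟨rfl, y, hy', rfl⟩ | ⟨rfl, g, hg, rfl⟩ | rfl := extPart_cases hy
    · rw [extLeft_mul]
      exact extLeft_mem_extPart (Q.mul_mem_degreePart hx' hy')
    · rw [extLeft_mul_extDual, zero_add]
      exact extDual_mem_extPart (comp_mulRight_mem_dualPart hx' hg)
    · rw [mul_zero]
      exact zero_mem _
  · obtain ⟨rfl, y, hy', rfl⟩ | ⟨rfl, g, hg, rfl⟩ | rfl := extPart_cases hy
    · rw [extDual_mul_extLeft, add_zero]
      exact extDual_mem_extPart (comp_mulLeft_mem_dualPart hy' hf)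
    · rw [extDual_mul_extDual]
      exact zero_mem _
    · rw [mul_zero]
      exact zero_mem _
  · rw [zero_mul]
    exact zero_mem _

/-- Functionals of weight zero live on Λ_(n+1), which vanishes by prolongation. -/
theorem extPart_zero_of_ne (h : Q.Prolongs n) {d : ℤ} (hd : d ≠ 0) : Q.extPart n d 0 = ⊥ := by
  rw [eq_bot_iff]
  intro x hx
  obtain ⟨rfl, _⟩ | ⟨rfl, f, hf, rfl⟩ | rfl := extPart_cases hx
  · exact (hd rfl).elim
  · have : f = 0 := LinearMap.ext fun x => by
      rw [eq_part_of_mem_dualPart (s := n + 1) (by omega) hf, LinearMap.zero_apply]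
      by_cases h0 : Q.part (n + 1) x = 0
      · rw [h0, map_zero]
      · have := h.le_of_ne_zero (Q.part_mem _ x) h0
        omega
    rw [this, map_zero]
    exact zero_mem _
  · exact zero_mem _

theorem extPart_succ_le [FiniteDimensional k Q.PathAlg] (h : Q.Prolongs n) (d : ℤ) (t : ℕ) :
    Q.extPart n d (t + 1) ≤ ⨆ d', Q.extPart n d' 1 * Q.extPart n (d - d') t := by
  intro x hx
  obtain ⟨rfl, x, hx', rfl⟩ | ⟨rfl, f, hf, rfl⟩ | rfl := extPart_cases hx
  · refine Submodule.mem_iSup_of_mem 0 ?_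
    rw [sub_self]
    clear hx
    induction hx' using degreePart_induction with
    | path i j p hp =>
      cases p with
      | nil => simp at hp
      | cons p α =>
        rw [← Path.comp_toPath_eq_cons, ← ofPath_mul_ofPath, ← extLeft_mul]
        have hp' : p.length = t := by simpa using hp
        exact Submodule.mul_mem_mul (extLeft_mem_extPart
          (Q.ofPath_mem_of_length _ (Path.length_toPath α)))
          (extLeft_mem_extPart (Q.ofPath_mem_of_length p hp'))
    | zero => rw [map_zero]; exact zero_mem _
    | add x y _ _ h₁ h₂ => rw [map_add]; exact add_mem h₁ h₂
    | smul c x _ h => rw [map_smul]; exact Submodule.smul_mem _ c h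
  · have hf' := h.dualPart_succ_le t hf
    clear hx hf
    induction hf' using Submodule.span_induction with
    | mem f h =>
      obtain ⟨x, hx, g, hg, rfl⟩ | ⟨g, hg, x, hx, rfl⟩ := h
      · refine Submodule.mem_iSup_of_mem 0 ?_
        rw [← extLeft_mul_extDual, sub_zero]
        exact Submodule.mul_mem_mul (extLeft_mem_extPart hx) (extDual_mem_extPart hg)
      · refine Submodule.mem_iSup_of_mem 1 ?_
        rw [← extDual_mul_extLeft, sub_self]
        exact Submodule.mul_mem_mul (extDual_mem_extPart hg) (extLeft_mem_extPart hx)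
    | zero => rw [map_zero]; exact zero_mem _
    | add x y _ _ h₁ h₂ => rw [map_add]; exact add_mem h₁ h₂
    | smul c x _ h => rw [map_smul]; exact Submodule.smul_mem _ c h
  · exact zero_mem _

theorem extPart_independent (d : ℤ) (s : Finset ℕ)
    (x : ℕ → Module.End k (Q.PathAlg × Module.Dual k Q.PathAlg))
    (hx : ∀ t, x t ∈ Q.extPart n d t) (hsum : ∑ t ∈ s, x t = 0) (t : ℕ) (ht : t ∈ s) :
    x t = 0 := by
  by_cases h₀ : d = 0
  · subst h₀
    simp only [extPart_zero, Submodule.mem_map] at hx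
    choose y hy hyx using hx
    obtain rfl : (fun t => extLeft k Q.PathAlg (y t)) = x := funext hyx
    rw [← map_sum] at hsum
    have hsum' := extLeft_injective (hsum.trans (map_zero _).symm)
    have := congrArg (Q.part t) hsum'
    rw [map_sum, Finset.sum_eq_single t, Q.part_of_mem (hy t), map_zero] at this
    · change extLeft k Q.PathAlg (y t) = 0
      rw [this, map_zero]
    · intro r _ hr
      exact Q.part_of_mem_ne (hy r) hr
    · exact fun h => (h ht).elim
  by_cases h₁ : d = 1
  · subst h₁
    simp only [extPart_one, Submodule.mem_map] at hx
    choose f hf hfx using hx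
    obtain rfl : (fun t => extDual k Q.PathAlg (f t)) = x := funext hfx
    rw [← map_sum] at hsum
    have hsum' := extDual_injective (hsum.trans (map_zero _).symm)
    have hft : f t = 0 := by
      by_cases htn : n + 1 < t
      · exact eq_zero_of_mem_dualPart htn (hf t)
      refine LinearMap.ext fun z => ?_
      have := congrArg (fun g => g (Q.part (n + 1 - t) z)) hsum'
      simp only [LinearMap.sum_apply, LinearMap.zero_apply] at this
      rw [Finset.sum_eq_single t] at this
      · rw [eq_part_of_mem_dualPart (s := n + 1 - t) (by omega) (hf t), this, LinearMap.zero_apply]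
      · intro r _ hr
        exact hf r _ (by omega) _ (Q.part_mem _ z)
      · exact fun h => (h ht).elim
    change extDual k Q.PathAlg (f t) = 0
    rw [hft, map_zero]
  · have := hx t
    rwa [extPart_of_ne Q n h₀ h₁] at this

theorem extForm_comm {d d' : ℤ} {s t : ℕ}
    {x y : Module.End k (Q.PathAlg × Module.Dual k Q.PathAlg)} (hx : x ∈ Q.extPart n d s)
    (hy : y ∈ Q.extPart n d' t) :
    extForm k Q.PathAlg (x * y) = extForm k Q.PathAlg (y * x) := by
  obtain ⟨_, x, hx, rfl⟩ | ⟨_, f, hf, rfl⟩ | rfl := extPart_cases hx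
  · obtain ⟨_, y, hy, rfl⟩ | ⟨_, g, hg, rfl⟩ | rfl := extPart_cases hy
    · rw [extLeft_mul, extLeft_mul, extForm_extLeft, extForm_extLeft]
    · rw [extLeft_mul_extDual, extDual_mul_extLeft, extForm_extDual, extForm_extDual]
      simp
    · simp
  · obtain ⟨_, y, hy, rfl⟩ | ⟨_, g, hg, rfl⟩ | rfl := extPart_cases hy
    · rw [extLeft_mul_extDual, extDual_mul_extLeft, extForm_extDual, extForm_extDual]
      simp
    · rw [extDual_mul_extDual, extDual_mul_extDual]
    · simp
  · simp

/-- This is the perfect pairing of Λ_t with the functionals supported on it, whose weight is n + 1 -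
t; prolongation enters through t ≤ n. -/
theorem exists_extForm_ne_zero (h : Q.Prolongs n) {d : ℤ} {t : ℕ}
    {x : Module.End k (Q.PathAlg × Module.Dual k Q.PathAlg)} (hx : x ∈ Q.extPart n d t)
    (hx0 : x ≠ 0) : ∃ t', t + t' = n + 1 ∧ ∃ y ∈ Q.extPart n (1 - d) t',
      extForm k Q.PathAlg (x * y) ≠ 0 := by
  obtain ⟨rfl, x, hx', rfl⟩ | ⟨rfl, f, hf, rfl⟩ | rfl := extPart_cases hx
  · have hx0' : x ≠ 0 := by
      rintro rfl
      exact hx0 (map_zero _)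
    have htn := h.le_of_ne_zero hx' hx0'
    obtain ⟨g, hg⟩ : ∃ g : Module.Dual k Q.PathAlg, g x ≠ 0 := by
      by_contra! hcon
      exact hx0' ((Module.forall_dual_apply_eq_zero_iff k x).1 hcon)
    refine ⟨n + 1 - t, by omega, extDual k Q.PathAlg (g ∘ₗ Q.part t), ?_, ?_⟩
    · rw [sub_zero]
      exact extDual_mem_extPart (comp_part_mem_dualPart (by omega) g)
    · rw [extLeft_mul_extDual, extForm_extDual, LinearMap.comp_apply, LinearMap.mulRight_apply,
        one_mul, LinearMap.comp_apply, Q.part_of_mem hx']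
      exact hg
  · have htn : t ≤ n + 1 := by
      by_contra hlt
      rw [eq_zero_of_mem_dualPart (by omega) hf, map_zero] at hx0
      exact hx0 rfl
    obtain ⟨z, hz⟩ : ∃ z, f z ≠ 0 := by
      by_contra! hcon
      rw [show f = 0 from LinearMap.ext hcon, map_zero] at hx0
      exact hx0 rfl
    refine ⟨n + 1 - t, by omega, extLeft k Q.PathAlg (Q.part (n + 1 - t) z), ?_, ?_⟩
    · rw [sub_self]
      exact extLeft_mem_extPart (Q.part_mem _ z)
    · rw [extDual_mul_extLeft, extForm_extDual, LinearMap.comp_apply, LinearMap.mulLeft_apply,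
        mul_one, ← eq_part_of_mem_dualPart (s := n + 1 - t) (by omega) hf]
      exact hz
  · exact (hx0 rfl).elim

theorem extPart_zero_zero {ι : Type u'} (σ : ι ≃ V) : Q.extPart n 0 0 = Submodule.span k
    (Set.range fun i => extLeft k Q.PathAlg (Q.ofPath (Path.nil : Path (σ i) (σ i)))) := by
  rw [extPart_zero]
  apply le_antisymm
  · rw [Submodule.map_le_iff_le_comap]
    intro x hx
    induction hx using degreePart_induction with
    | path a b p hp =>
      obtain ⟨i, rfl⟩ := σ.surjective a
      obtain rfl := Path.eq_of_length_zero p hp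
      obtain rfl := Path.eq_nil_of_length_zero p hp
      exact Submodule.subset_span ⟨i, rfl⟩
    | zero => exact zero_mem _
    | add x y _ _ h₁ h₂ => exact add_mem h₁ h₂
    | smul c x _ h => exact Submodule.smul_mem _ c h
  · rw [Submodule.span_le]
    rintro _ ⟨i, rfl⟩
    exact Submodule.mem_map_of_mem (Q.ofPath_mem_of_length _ Path.length_nil)

theorem exists_path_of_ne_zero {i j : V} {x : Q.PathAlg} {t : ℕ} (hx : x ∈ Q.degreePart t)
    (h0 : Q.ofPath (Path.nil : Path j j) * x * Q.ofPath (Path.nil : Path i i) ≠ 0) :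
    ∃ p : Path i j, p.length = t := by
  by_contra! hcon
  apply h0
  clear h0
  induction hx using degreePart_induction with
  | path a b p hp =>
    by_cases ha : i = a
    · by_cases hb : b = j
      · subst ha hb
        exact (hcon p hp).elim
      · rw [ofPath_mul_ofPath_of_ne _ _ _ hb, zero_mul]
    · rw [mul_assoc, ofPath_mul_ofPath_of_ne _ _ _ ha, mul_zero]
  | zero => simp
  | add x y _ _ h₁ h₂ => rw [mul_add, add_mul, h₁, h₂, add_zero]
  | smul c x _ h => rw [mul_smul_comm, smul_mul_assoc, h, smul_zero]

/-- The trivial extension of a bound quiver algebra whose dual is generated in degree `n`. -/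
def Prolongs.bigradedFrobenius (h : Q.Prolongs n) (hV : QuiverAcyclic V) {ι : Type u'} [Fintype ι]
    (σ : ι ≃ V) :
    BigradedFrobenius k ι (Module.End k (Q.PathAlg × Module.Dual k Q.PathAlg)) n where
  idem i := extLeft k Q.PathAlg (Q.ofPath (Path.nil : Path (σ i) (σ i)))
  part := Q.extPart n
  form := extForm k Q.PathAlg
  -- Reachability by nontrivial paths is a strict order exactly because Q is acyclic.
  rel i j := ∃ p : Path (σ i) (σ j), 0 < p.length
  idem_ne_zero i := by
    rw [Ne, map_eq_zero_iff _ extLeft_injective, ofPath_eq_zero_iff, not_not]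
    exact Q.isBoundPath_of_length_lt _ (by simp)
  idem_mul_self i := by
    rw [extLeft_mul, ofPath_mul_ofPath, Path.comp_nil]
  idem_mul_of_ne i j hij := by
    rw [extLeft_mul, ofPath_mul_ofPath_of_ne _ _ _ (σ.injective.ne hij.symm), map_zero]
  sum_idem := by
    let := Fintype.ofFinite V
    rw [← map_sum, Equiv.sum_comp σ fun i => Q.ofPath (Path.nil : Path i i), ← one_eq_sum,
      extLeft_one]
  part_zero := extPart_zero_zero σ
  part_zero_of_ne _ := extPart_zero_of_ne h
  mul_mem := extPart_mul_mem
  part_succ_le := haveI := Q.finiteDimensional hV; extPart_succ_le h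
  finite d := by
    have := Q.finiteDimensional hV
    infer_instance
  independent d s x hx hsum := extPart_independent d s x hx hsum
  form_comm := extForm_comm
  exists_form_ne_zero := exists_extForm_ne_zero h
  part_of_neg d hd := extPart_of_ne Q n (by omega) (by omega) 1
  rel_trans := by
    rintro i j l ⟨p, hp⟩ ⟨q, _⟩
    exact ⟨p.comp q, by rw [Path.length_comp]; omega⟩
  rel_irrefl := by
    rintro i ⟨p, hp⟩
    exact hp.ne' (hV _ p)
  rel_of_ne_zero := by
    intro i j x hx hx₁ hx₂ hx0
    rw [extPart_zero] at hx
    obtain ⟨y, hy, rfl⟩ := hx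
    obtain ⟨p, hp⟩ := exists_path_of_ne_zero (i := σ i) (j := σ j) hy (by
      intro h0
      rw [extLeft_mul] at hx₁ hx₂
      rw [extLeft_injective hx₁, extLeft_injective hx₂] at h0
      rw [h0, map_zero] at hx0
      exact hx0 rfl)
    exact ⟨p, by omega⟩

end BoundQuiver

namespace BoundQuiver

variable {k : Type w} [Field k] {V : Type u} [Quiver.{v} V] [Finite V] (Q : BoundQuiver k V)
  {B : Type*} [Ring B] [Algebra k B]

/-! ### Homomorphisms from bound quiver algebras -/

/-- The linear map given by linear maps on the entries. -/
def sumEntries (f : ∀ i j, Q.HomSpace i j →ₗ[k] B) : Q.PathAlg →ₗ[k] B :=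
  letI := Fintype.ofFinite V
  ∑ i, ∑ j, f i j ∘ₗ Q.entry i j

theorem sumEntries_ofHom (f : ∀ i j, Q.HomSpace i j →ₗ[k] B) {i j : V} (x : Q.HomSpace i j) :
    Q.sumEntries f (Q.ofHom i j x) = f i j x := by
  rw [sumEntries, LinearMap.sum_apply, Finset.sum_eq_single i, LinearMap.sum_apply,
    Finset.sum_eq_single j, LinearMap.comp_apply, entry_ofHom]
  · intro l _ h
    rw [LinearMap.comp_apply, entry_ofHom_right_ne _ _ _ h, map_zero]
  · simp
  · intro l _ h
    rw [LinearMap.sum_apply]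
    refine Finset.sum_eq_zero fun m _ => ?_
    rw [LinearMap.comp_apply, entry_ofHom_left_ne _ _ h, map_zero]
  · simp

/-- The algebra homomorphism given by a multiplicative family of linear maps on the entries. -/
def liftAlgHom (f : ∀ i j, Q.HomSpace i j →ₗ[k] B)
    (comp : ∀ {i j l} (x : Q.HomSpace i j) (y : Q.HomSpace j l),
      f i l (Q.homComp i j l x y) = f j l y * f i j x)
    (comp_of_ne : ∀ {i j j' l} (x : Q.HomSpace i j) (y : Q.HomSpace j' l), j ≠ j' →
      f j' l y * f i j x = 0)
    (one : letI := Fintype.ofFinite V; ∑ i, f i i (Q.pathClass Path.nil) = 1) :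
    Q.PathAlg →ₐ[k] B :=
  AlgHom.ofLinearMap (Q.sumEntries f)
    (by
      let := Fintype.ofFinite V
      rw [one_eq_sum, map_sum, ← one]
      exact Finset.sum_congr rfl fun i _ => Q.sumEntries_ofHom f _)
    (by
      intro x y
      induction x using pathAlg_induction with
      | path i j p =>
        induction y using pathAlg_induction with
        | path a b q =>
          rw [ofPath_eq, ofPath_eq, sumEntries_ofHom, sumEntries_ofHom]
          by_cases h : b = i
          · subst h
            rw [ofHom_mul_ofHom, sumEntries_ofHom, comp]
          · rw [ofHom_mul_ofHom_of_ne _ _ _ h, map_zero, comp_of_ne _ _ h]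
        | zero => simp
        | add y z h₁ h₂ => rw [mul_add, map_add, map_add, mul_add, h₁, h₂]
        | smul c y h => rw [mul_smul_comm, map_smul, map_smul, mul_smul_comm, h]
      | zero => simp
      | add y z h₁ h₂ => rw [add_mul, map_add, map_add, add_mul, h₁, h₂]
      | smul c y h => rw [smul_mul_assoc, map_smul, map_smul, smul_mul_assoc, h])

theorem liftAlgHom_ofHom {f : ∀ i j, Q.HomSpace i j →ₗ[k] B} {comp comp_of_ne one}
    {i j : V} (x : Q.HomSpace i j) :
    Q.liftAlgHom f comp comp_of_ne one (Q.ofHom i j x) = f i j x :=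
  Q.sumEntries_ofHom f x

theorem ofPath_nil_mul_mul_ofPath_nil (i j : V) (x : Q.PathAlg) :
    Q.ofPath (Path.nil : Path j j) * x * Q.ofPath (Path.nil : Path i i) =
      Q.ofHom i j (Q.entry i j x) := by
  induction x using pathAlg_induction with
  | path a b p =>
    by_cases ha : i = a
    · by_cases hb : b = j
      · subst ha hb
        rw [ofPath_mul_ofPath, ofPath_mul_ofPath, Path.nil_comp, Path.comp_nil, ofPath_eq,
          entry_ofHom]
      · rw [ofPath_mul_ofPath_of_ne _ _ _ hb, zero_mul, ofPath_eq,
          entry_ofHom_right_ne _ _ _ (Ne.symm hb), map_zero]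
    · rw [mul_assoc, ofPath_mul_ofPath_of_ne _ _ _ ha, mul_zero, ofPath_eq,
        entry_ofHom_left_ne _ _ ha, map_zero]
  | zero => simp
  | add x y h₁ h₂ => rw [mul_add, add_mul, h₁, h₂, map_add, map_add]
  | smul c x h => rw [mul_smul_comm, smul_mul_assoc, h, map_smul, map_smul]

/-- Multiplying by trivial paths on both sides isolates an entry, so an element of the kernel has
all its entries in the kernels of the given maps. -/
theorem liftAlgHom_injective {f : ∀ i j, Q.HomSpace i j →ₗ[k] B} {comp comp_of_ne one}
    (hf : ∀ i j, Function.Injective (f i j)) :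
    Function.Injective (Q.liftAlgHom f comp comp_of_ne one) := by
  rw [injective_iff_map_eq_zero]
  intro x hx
  refine Q.pathAlg_ext fun i j => hf i j ?_
  rw [map_zero, map_zero, ← Q.liftAlgHom_ofHom (comp := comp) (comp_of_ne := comp_of_ne)
    (one := one), ← ofPath_nil_mul_mul_ofPath_nil, map_mul, map_mul, hx, mul_zero, zero_mul]

end BoundQuiver

/-! ### The slice of level zero -/

namespace GradedHoms

variable {k : Type w} [Field k] {W : Type u'} [Quiver.{v'} W] {E : Type*} [Ring E] [Algebra k E]
  (C : GradedHoms k W E)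

theorem idem_mul_eval {a b : W} (x : Path a b →₀ k) : C.idem b * C.eval a b x = C.eval a b x := by
  induction x using Finsupp.induction_linear with
  | zero => simp
  | add x y h₁ h₂ => rw [map_add, mul_add, h₁, h₂]
  | single p c => rw [eval_single, mul_smul_comm, C.idem_mul (C.val_mem p)]

theorem eval_mul_idem {a b : W} (x : Path a b →₀ k) : C.eval a b x * C.idem a = C.eval a b x := by
  induction x using Finsupp.induction_linear with
  | zero => simp
  | add x y h₁ h₂ => rw [map_add, add_mul, h₁, h₂]
  | single p c => rw [eval_single, smul_mul_assoc, C.mul_idem (C.val_mem p)]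

open FullSub

variable {S : Set W} (hS : ∀ i j l : W, Path i j → Path j l → i ∈ S → l ∈ S → j ∈ S)

/-- The morphism given by an entry of the algebra of a convex full subquiver. -/
def restrictEval (i j : FullSub S) : (C.boundQuiver.restrict S).HomSpace i j →ₗ[k] E :=
  ((C.boundQuiver.restrict S).relIdeal i j).liftQ (C.eval i.1 j.1 ∘ₗ inclMap k i j) fun x hx => by
    rw [BoundQuiver.mem_restrict_relIdeal _ hS, mem_relIdeal_iff] at hx
    exact hx

theorem restrictEval_mk {i j : FullSub S} (x : Path i j →₀ k) :
    C.restrictEval hS i j (Submodule.Quotient.mk x) = C.eval i.1 j.1 (inclMap k i j x) := rfl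

theorem restrictEval_injective (i j : FullSub S) :
    Function.Injective (C.restrictEval hS i j) := by
  rw [injective_iff_map_eq_zero]
  intro x hx
  obtain ⟨x, rfl⟩ := Submodule.Quotient.mk_surjective _ x
  rw [restrictEval_mk] at hx
  rwa [Submodule.Quotient.mk_eq_zero, BoundQuiver.mem_restrict_relIdeal _ hS, mem_relIdeal_iff]

theorem restrictEval_homComp {i j l : FullSub S} (x : (C.boundQuiver.restrict S).HomSpace i j)
    (y : (C.boundQuiver.restrict S).HomSpace j l) :
    C.restrictEval hS i l ((C.boundQuiver.restrict S).homComp i j l x y) =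
      C.restrictEval hS j l y * C.restrictEval hS i j x := by
  obtain ⟨x, rfl⟩ := Submodule.Quotient.mk_surjective _ x
  obtain ⟨y, rfl⟩ := Submodule.Quotient.mk_surjective _ y
  rw [BoundQuiver.homComp_mk, restrictEval_mk, restrictEval_mk, restrictEval_mk, inclMap_pathComp,
    eval_pathComp]

theorem restrictEval_mul_of_ne (horth : ∀ i j : FullSub S, i ≠ j → C.idem i.1 * C.idem j.1 = 0)
    {i j j' l : FullSub S} (x : (C.boundQuiver.restrict S).HomSpace i j)
    (y : (C.boundQuiver.restrict S).HomSpace j' l) (h : j ≠ j') :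
    C.restrictEval hS j' l y * C.restrictEval hS i j x = 0 := by
  obtain ⟨x, rfl⟩ := Submodule.Quotient.mk_surjective _ x
  obtain ⟨y, rfl⟩ := Submodule.Quotient.mk_surjective _ y
  rw [restrictEval_mk, restrictEval_mk, ← C.eval_mul_idem (inclMap k j' l y),
    ← C.idem_mul_eval (inclMap k i j x), mul_assoc, ← mul_assoc (C.idem j'.1), horth _ _ h.symm,
    zero_mul, mul_zero]

theorem restrictEval_nil (i : FullSub S) : C.restrictEval hS i i
    ((C.boundQuiver.restrict S).pathClass Path.nil) = C.idem i.1 := by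
  rw [BoundQuiver.pathClass, restrictEval_mk, inclMap_single, eval_single, one_smul]
  rfl

end GradedHoms

namespace BigradedFrobenius

variable {k : Type w} [Field k] {ι : Type u'} [Fintype ι] {E : Type*} [Ring E] [Algebra k E]
  {n : ℕ} (F : BigradedFrobenius k ι E n)

/-- The vertices of level zero are the indices of the idempotents. -/
def zeroLevelEquiv (ι : Type u') : FullSub (CoverVertex.zeroLevel ι) ≃ ι where
  toFun a := a.1.vertex
  invFun i := ⟨⟨i, 0⟩, rfl⟩
  left_inv := by
    rintro ⟨⟨i, m⟩, h⟩
    obtain rfl : m = 0 := h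
    rfl
  right_inv _ := rfl

/-- Between vertices of level zero the morphisms of the covering have first degree zero, and the
Peirce decomposition with respect to the idempotents reassembles them into that part of E. -/
theorem exists_algHom_zeroLevel [Finite (FullSub (CoverVertex.zeroLevel ι))] :
    letI := F.coverQuiver.{w, u', v'}
    ∃ Φ : (F.cover.boundQuiver.restrict (CoverVertex.zeroLevel ι)).PathAlg →ₐ[k] E,
      Function.Injective Φ ∧ ∀ x, x ∈ Φ.range ↔ x ∈ ⨆ t, F.part 0 t := by
  let := F.coverQuiver.{w, u', v'}
  let hS := F.isCompleteSlice_zeroLevel.{w, u', v'}.convex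
  let := Fintype.ofFinite (FullSub (CoverVertex.zeroLevel ι))
  have hone : ∑ i, F.cover.restrictEval hS i i
      ((F.cover.boundQuiver.restrict (CoverVertex.zeroLevel ι)).pathClass Path.nil) = 1 := by
    simp only [GradedHoms.restrictEval_nil]
    rw [← F.sum_idem]
    exact Equiv.sum_comp (zeroLevelEquiv ι) F.idem
  have horth : ∀ i j : FullSub (CoverVertex.zeroLevel ι), i ≠ j →
      F.cover.idem i.1 * F.cover.idem j.1 = 0 := fun i j hij =>
    F.idem_mul_of_ne _ _ fun h => hij ((zeroLevelEquiv ι).injective h)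
  refine ⟨BoundQuiver.liftAlgHom _ (F.cover.restrictEval hS) (F.cover.restrictEval_homComp hS)
    (F.cover.restrictEval_mul_of_ne hS horth) hone,
    BoundQuiver.liftAlgHom_injective _ (F.cover.restrictEval_injective hS), fun x => ⟨?_, ?_⟩⟩
  · rintro ⟨y, rfl⟩
    change BoundQuiver.liftAlgHom _ _ _ _ _ y ∈ _
    induction y using BoundQuiver.pathAlg_induction with
    | path i j p =>
      rw [BoundQuiver.ofPath_eq, BoundQuiver.liftAlgHom_ofHom, BoundQuiver.pathClass,
        GradedHoms.restrictEval_mk]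
      have h := (F.cover.eval_mem (FullSub.inclMap_mem_homogeneous k
        (BoundQuiver.single_mem_homogeneous p (1 : k)))).1
      have hi : i.1.level = 0 := i.2
      have hj : j.1.level = 0 := j.2
      rw [hi, hj, sub_zero] at h
      exact Submodule.mem_iSup_of_mem _ h
    | zero => rw [map_zero]; exact zero_mem _
    | add x y h₁ h₂ => rw [map_add]; exact add_mem h₁ h₂
    | smul c x h => rw [map_smul]; exact Submodule.smul_mem _ c h
  · intro hx
    rw [← Subalgebra.mem_toSubmodule]
    refine (iSup_le fun t y hy => ?_ : (⨆ t, F.part 0 t) ≤ _) hx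
    have hsum : y = ∑ j, ∑ i, F.idem j * y * F.idem i := by
      simp only [← Finset.mul_sum, F.sum_idem, mul_one, ← Finset.sum_mul, one_mul]
    rw [hsum]
    refine Submodule.sum_mem _ fun j _ => Submodule.sum_mem _ fun i _ => ?_
    obtain ⟨i, rfl⟩ := (zeroLevelEquiv ι).surjective i
    obtain ⟨j, rfl⟩ := (zeroLevelEquiv ι).surjective j
    have hi : i.1.level = 0 := i.2
    have hj : j.1.level = 0 := j.2
    obtain ⟨z, _, hz⟩ := F.cover.exists_eval_eq (a := i.1) (b := j.1)
      (F.idem_mul_mul_idem_mem (a := i.1) (b := j.1) (by rwa [hi, hj, sub_zero]))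
    obtain ⟨z, rfl⟩ := FullSub.inclMap_surjective k hS i j z
    refine ⟨BoundQuiver.ofHom _ i j (Submodule.Quotient.mk z), ?_⟩
    exact (BoundQuiver.liftAlgHom_ofHom _ _).trans hz

end BigradedFrobenius

/-! ### Realising Λ as a slice algebra -/

namespace BoundQuiver

variable {k : Type w} [Field k] {V : Type u} [Quiver.{v} V] [Finite V] {Q : BoundQuiver k V}
  {n : ℕ}

theorem extLeft_mem_iSup (x : Q.PathAlg) :
    extLeft k Q.PathAlg x ∈ ⨆ t, Q.extPart n 0 t := by
  have : x ∈ (⨆ t, Q.extPart n 0 t).comap (extLeft k Q.PathAlg) :=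
    Q.mem_of_part_mem _ fun t =>
      Submodule.mem_iSup_of_mem t (extLeft_mem_extPart (Q.part_mem t x))
  exact this

theorem Prolongs.isTauSliceAlgebra (h : Q.Prolongs n) (hV : QuiverAcyclic V) :
    IsTauSliceAlgebra.{w, u', v'} k n Q.PathAlg := by
  -- A lifted copy of `Fin m` replaces V, so that the covering has its vertices in the prescribed
  -- universe.
  obtain ⟨m, ⟨σ⟩⟩ := Finite.exists_equiv_fin V
  let F : BigradedFrobenius k (ULift.{u'} (Fin m))
      (Module.End k (Q.PathAlg × Module.Dual k Q.PathAlg)) n :=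
    h.bigradedFrobenius hV (Equiv.ulift.trans σ.symm)
  let := F.coverQuiver.{w, u', v'}
  refine ⟨CoverVertex (ULift.{u'} (Fin m)), inferInstance, F.cover.boundQuiver,
    CoverVertex.translation, CoverVertex.finite_orbits, CoverVertex.zeroLevel _,
    F.isCompleteSlice_zeroLevel, F.quiverAcyclic_cover, F.isStableTranslation_cover, ?_⟩
  have := F.isCompleteSlice_zeroLevel.finite CoverVertex.finite_orbits
  obtain ⟨Φ, hΦ, hrange⟩ := F.exists_algHom_zeroLevel
  let L : Q.PathAlg →ₐ[k] Module.End k (Q.PathAlg × Module.Dual k Q.PathAlg) :=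
    AlgHom.ofLinearMap (extLeft k Q.PathAlg) extLeft_one fun x y => (extLeft_mul x y).symm
  -- Λ and the slice algebra embed in the same endomorphism algebra with the same image, the part of
  -- first degree zero; this gives the isomorphism.
  have hL : L.range = Φ.range := by
    ext x
    rw [hrange]
    constructor
    · rintro ⟨y, rfl⟩
      exact extLeft_mem_iSup (n := n) y
    · intro hx
      rw [← Subalgebra.mem_toSubmodule]
      refine (iSup_le fun t y hy => ?_ : (⨆ t, F.part 0 t) ≤ _) hx
      change y ∈ Q.extPart n 0 t at hy
      rw [extPart_zero] at hy
      obtain ⟨z, _, rfl⟩ := hy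
      exact ⟨z, rfl⟩
  exact ⟨(AlgEquiv.ofInjective L extLeft_injective).trans
    ((Subalgebra.equivOfEq _ _ hL).trans (AlgEquiv.ofInjective Φ hΦ).symm)⟩

end BoundQuiver

theorem IsTauSliceAlgebra.of_algEquiv {k : Type w} [Field k] {n : ℕ} {A B : Type*} [Ring A]
    [Algebra k A] [Ring B] [Algebra k B] (e : A ≃ₐ[k] B)
    (h : IsTauSliceAlgebra.{w, u', v'} k n B) : IsTauSliceAlgebra.{w, u', v'} k n A := by
  obtain ⟨W, _, R, τ, hτ, S, hS, hW, hR, ⟨e'⟩⟩ := h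
  have := hS.finite hτ
  exact ⟨W, _, R, τ, hτ, S, hS, hW, hR, ⟨e.trans e'⟩⟩

end

theorem proposition6p3 {k : Type w} [Field k] {V : Type u} [Quiver.{v} V] [Finite V]
    (hV : QuiverAcyclic V) (Q : BoundQuiver k V) (A : Type*) [Ring A] [Algebra k A]
    (e : A ≃ₐ[k] Q.PathAlg) (n : ℕ) :
    IsTauSliceAlgebra.{w, u', v'} k n A ↔ Q.IsNHomogeneous n ∧ Q.DualGeneratedBy n := by
  constructor
  · intro h
    -- The grading-free condition travels from the slice to A and on to the presentation by Q, where
    -- it is translated back into a statement about path lengths.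
    have hdual := Q.dualGeneratedBy_of_socleInPower hV (h.socleInPower.of_algEquiv e)
    exact ⟨hdual.prolongs.isNHomogeneous, hdual⟩
  · rintro ⟨_, hdual⟩
    exact (hdual.prolongs.isTauSliceAlgebra hV).of_algEquiv e
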